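/- Let $\Omega\subset\mathbb{R}^n$ be an open bounded Lipschitz domain with volume measure ${\rm d}x$, surface measure ${\rm d}S$ on $\partial\Omega$, and outward unit normal $\hat n$ (defined a.e. on $\partial\Omega$), and let $p\in(1,\infty)$. Let $f,a,c:\overline\Omega\times\mathbb{R}^m\times\mathbb{R}^{m\times n}\to\mathbb{R}$ be continuous on $\Omega\times\mathbb{R}^m\times\mathbb{R}^{m\times n}$, let $g,b,d:\partial\Omega\times\mathbb{R}^m\to\mathbb{R}$ be continuous, and suppose that $|f|,|a|\le C(1+|y|^p+|z|^p)$ for a.e. $x\in\Omega$ and all $y,z$, and $|g|,|b|\le C(1+|y|^p)$ for a.e. $x\in\partial\Omega$ and all $y$, for some constant $C$. Call $u\in W^{1,p}(\Omega;\mathbb{R}^m)$ admissible if $$\int_\Omega a(x,u,\nabla u)\,{\rm d}x+\int_{\partial\Omega}b(x,u)\,{\rm d}S=0,\qquad c(x,u,\nabla u)=0\ \text{a.e. on }\Omega,\qquad d(x,u)=0\ \text{a.e. on }\partial\Omega,$$ where $u$ on $\partial\Omega$ means the trace of $u$, and put $$\Psi(u)=\int_\Omega f(x,u,\nabla u)\,{\rm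 d}x+\int_{\partial\Omega}g(x,u)\,{\rm d}S,\qquad \mathcal{F}^*=\inf\{\Psi(u):u\text{ admissible}\}.$$ Let $\Phi_p$ be the set of $\phi\in C^1(\overline\Omega\times\mathbb{R}^m;\mathbb{R}^n)$ for which, with some constant $C$, $\sum_{i,j}|\partial_{y_j}\phi_i|\le C(1+|y|^{p-1})$ and $\sum_i|\phi_i|+\sum_i|\partial_{x_i}\phi_i|\le C(1+|y|^p)$ on $\overline\Omega\times\mathbb{R}^m$, and put $\mathcal{D}\phi(x,y,z)=\sum_i\partial_{x_i}\phi_i(x,y)+\sum_{i,j}\partial_{y_j}\phi_i(x,y)z_{ji}$. For $\phi\in\Phi_p$, $\eta\in\mathbb{R}$, $h\in C(\overline\Omega)$, $\ell\in C(\partial\Omega)$ put $$F^{\phi,\eta,h}(x,y,z)=f+\mathcal{D}\phi-\eta\,a-h(x),\qquad G^{\phi,\eta,\ell}(x,y)=g-\phi\cdot\hat n(x)-\eta\,b-\ell(x),$$ let $\mathbb{B}$ be the set of all such $(\phi,\eta,h,\ell)$ with $F^{\phi,\eta,h}\ge0$ on $\{(x,y,z)\in\overline\Omega\times\mathbb{R}^m\times\mathbb{R}^{m\times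 n}:c(x,y,z)=0\}$ and $G^{\phi,\eta,\ell}\ge0$ at every point of $\{(x,y)\in\partial\Omega\times\mathbb{R}^m:d(x,y)=0\}$ for which $\hat n(x)$ exists, and let $$\mathcal{L}_{\rm pdr}=\sup_{(\phi,\eta,h,\ell)\in\mathbb{B}}\Big\{\int_\Omega h\,{\rm d}x+\int_{\partial\Omega}\ell\,{\rm d}S\Big\}.$$ Suppose that $\mathcal{F}^*=\mathcal{L}_{\rm pdr}$. Given $\varepsilon>0$, let $u$ be admissible with $\Psi(u)\le\mathcal{F}^*+\varepsilon$, and let $(\phi,\eta,h,\ell)\in\mathbb{B}$ satisfy $\mathcal{F}^*-\varepsilon\le\int_\Omega h\,{\rm d}x+\int_{\partial\Omega}\ell\,{\rm d}S$. Then, for every $\delta>0$, the volume measure $\lambda_\delta$ of $\{x\in\Omega:F^{\phi,\eta,h}(x,u(x),\nabla u(x))\ge\delta\}$ and the surface measure $\sigma_\delta$ of $\{x\in\partial\Omega:G^{\phi,\eta,\ell}(x,u(x))\ge\delta\}$ satisfy $$\lambda_\delta+\sigma_\delta\le\frac{2\varepsilon}{\delta}.$$ -/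

import Mathlib

open MeasureTheory Filter Topology Set
open scoped ContDiff ENNReal RealInnerProductSpace

/-- The Euclidean space `ℝᵏ`. -/
abbrev Euc (k : ℕ) : Type := EuclideanSpace ℝ (Fin k)

/-- Gradients of maps `ℝⁿ → ℝᵐ`.  The `m × n` matrix `z` is identified with the linear map it
represents: the entry `z_{ji}` is `(z eᵢ)_j`, see `matEntry`. -/
abbrev Grad (n m : ℕ) : Type := Euc n →L[ℝ] Euc m

/-- The entry `z_{ji}` of the matrix of `z`. -/
noncomputable def matEntry {n m : ℕ} (z : Grad n m) (j : Fin m) (i : Fin n) : ℝ :=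
  z (EuclideanSpace.single i 1) j

/-- Bounded open Lipschitz sets: near every boundary point `x₀`, there are a direction `e` and a
Lipschitz function `γ` of the variables orthogonal to `e` (i.e. constant along `e`), such that
`Ω` is the region above the graph of `γ` in direction `e`. -/
structure IsLipschitzDomain {n : ℕ} (Ω : Set (Euc n)) : Prop where
  isOpen : IsOpen Ω
  isBounded : Bornology.IsBounded Ω
  graph : ∀ x₀ ∈ frontier Ω, ∃ (e : Euc n) (γ : Euc n → ℝ),
    ‖e‖ = 1 ∧ (∃ K, LipschitzWith K γ) ∧ (∀ (x : Euc n) (t : ℝ), γ (x + t • e) = γ x) ∧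
      ∀ᶠ x in 𝓝 x₀, (x ∈ Ω ↔ γ x < ⟪x, e⟫)

/-- The surface measure on `∂Ω`: the restriction to `∂Ω` of the `(n-1)`-dimensional Hausdorff
measure, normalized so that it agrees with Lebesgue measure on `(n-1)`-dimensional planes. -/
noncomputable def surfaceMeasure {n : ℕ} (Ω : Set (Euc n)) : Measure (Euc n) :=
  (Measure.euclideanHausdorffMeasure (n - 1) : Measure (Euc n)).restrict (frontier Ω)

/-- `ν` is the outward unit normal to `Ω` at `x`: near `x`, up to cones of arbitrarily small
aperture around the tangent plane `ν^⊥`, the set `Ω` is the half-space opposite to `ν`.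
There is at most one such `ν` at a boundary point. -/
def IsOutwardUnitNormal {n : ℕ} (Ω : Set (Euc n)) (x ν : Euc n) : Prop :=
  ‖ν‖ = 1 ∧ ∀ κ : ℝ, 0 < κ → ∀ᶠ y in 𝓝 x,
    (⟪y - x, ν⟫ < -(κ * ‖y - x‖) → y ∈ Ω) ∧ (κ * ‖y - x‖ < ⟪y - x, ν⟫ → y ∉ Ω)

/-- The boundary points at which the outward unit normal exists.  By Rademacher's theorem these
are almost all points of `∂Ω` when `Ω` is a Lipschitz domain. -/
def regularBoundary {n : ℕ} (Ω : Set (Euc n)) : Set (Euc n) :=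
  {x ∈ frontier Ω | ∃ ν, IsOutwardUnitNormal Ω x ν}

open Classical in
/-- The outward unit normal `n̂(x)` (with value `0` at points where there is none). -/
noncomputable def outwardNormal {n : ℕ} (Ω : Set (Euc n)) (x : Euc n) : Euc n :=
  if hx : ∃ ν, IsOutwardUnitNormal Ω x ν then hx.choose else 0

/-- `Du` is the weak gradient of `u` on the open set `Ω`. -/
def IsWeakGradient {n m : ℕ} (Ω : Set (Euc n)) (u : Euc n → Euc m) (Du : Euc n → Grad n m) :
    Prop :=
  ∀ ψ : Euc n → ℝ, ContDiff ℝ ∞ ψ → HasCompactSupport ψ → tsupport ψ ⊆ Ω → ∀ v : Euc n,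
    ∫ x in Ω, (fderiv ℝ ψ x v) • u x = -∫ x in Ω, ψ x • Du x v

/-- `u` belongs to `W^{1,p}(Ω; ℝᵐ)` and `Du` is (a representative of) its weak gradient. -/
structure IsSobolev {n m : ℕ} (Ω : Set (Euc n)) (p : ℝ) (u : Euc n → Euc m)
    (Du : Euc n → Grad n m) : Prop where
  memLp : MemLp u (ENNReal.ofReal p) (volume.restrict Ω)
  memLp_grad : MemLp Du (ENNReal.ofReal p) (volume.restrict Ω)
  isWeakGradient : IsWeakGradient Ω u Du

/-- `w` is (a representative of) the trace on `∂Ω` of `u ∈ W^{1,p}(Ω; ℝᵐ)`, where `Du = ∇u`: the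
trace operator `W^{1,p}(Ω) → L^p(∂Ω)` is the extension by continuity of the restriction
`s ↦ s|_{∂Ω}` of maps `s` that are smooth up to the boundary. -/
def IsTrace {n m : ℕ} (Ω : Set (Euc n)) (p : ℝ) (u : Euc n → Euc m) (Du : Euc n → Grad n m)
    (w : Euc n → Euc m) : Prop :=
  MemLp w (ENNReal.ofReal p) (surfaceMeasure Ω) ∧
    ∃ s : ℕ → Euc n → Euc m, (∀ k, ContDiff ℝ ∞ (s k)) ∧
      Tendsto (fun k => eLpNorm (fun x => s k x - u x) (ENNReal.ofReal p) (volume.restrict Ω))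
        atTop (𝓝 0) ∧
      Tendsto (fun k => eLpNorm (fun x => fderiv ℝ (s k) x - Du x) (ENNReal.ofReal p)
        (volume.restrict Ω)) atTop (𝓝 0) ∧
      Tendsto (fun k => eLpNorm (fun x => s k x - w x) (ENNReal.ofReal p) (surfaceMeasure Ω))
        atTop (𝓝 0)

/-- The data of the integral variational problem, with the standing assumptions on them. -/
structure VariationalProblem (n m : ℕ) where
  /-- the domain -/
  Ω : Set (Euc n)
  /-- the Sobolev exponent -/
  p : ℝ
  /-- bulk integrand of the functional -/
  f : Euc n → Euc m → Grad n m → ℝ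
  /-- boundary integrand of the functional -/
  g : Euc n → Euc m → ℝ
  /-- bulk integrand of the integral constraint -/
  a : Euc n → Euc m → Grad n m → ℝ
  /-- boundary integrand of the integral constraint -/
  b : Euc n → Euc m → ℝ
  /-- pointwise constraint in the bulk -/
  c : Euc n → Euc m → Grad n m → ℝ
  /-- pointwise constraint on the boundary -/
  d : Euc n → Euc m → ℝ
  lipschitz : IsLipschitzDomain Ω
  one_lt_p : 1 < p
  f_cont : ContinuousOn (fun q : Euc n × Euc m × Grad n m => f q.1 q.2.1 q.2.2) (Ω ×ˢ univ)
  a_cont : ContinuousOn (fun q : Euc n × Euc m × Grad n m => a q.1 q.2.1 q.2.2) (Ω ×ˢ univ)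
  c_cont : ContinuousOn (fun q : Euc n × Euc m × Grad n m => c q.1 q.2.1 q.2.2) (Ω ×ˢ univ)
  g_cont : ContinuousOn (fun q : Euc n × Euc m => g q.1 q.2) (frontier Ω ×ˢ univ)
  b_cont : ContinuousOn (fun q : Euc n × Euc m => b q.1 q.2) (frontier Ω ×ˢ univ)
  d_cont : ContinuousOn (fun q : Euc n × Euc m => d q.1 q.2) (frontier Ω ×ˢ univ)
  f_growth : ∃ C : ℝ, ∀ᵐ x ∂(volume.restrict Ω), ∀ y z, |f x y z| ≤ C * (1 + ‖y‖ ^ p + ‖z‖ ^ p)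
  a_growth : ∃ C : ℝ, ∀ᵐ x ∂(volume.restrict Ω), ∀ y z, |a x y z| ≤ C * (1 + ‖y‖ ^ p + ‖z‖ ^ p)
  g_growth : ∃ C : ℝ, ∀ᵐ x ∂(surfaceMeasure Ω), ∀ y, |g x y| ≤ C * (1 + ‖y‖ ^ p)
  b_growth : ∃ C : ℝ, ∀ᵐ x ∂(surfaceMeasure Ω), ∀ y, |b x y| ≤ C * (1 + ‖y‖ ^ p)

namespace VariationalProblem

variable {n m : ℕ} (P : VariationalProblem n m)

/-- The functional `Ψ(u) = ∫_Ω f(x,u,∇u) dx + ∫_{∂Ω} g(x,u) dS`, where `Du = ∇u` and `w` is the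
trace of `u`. -/
noncomputable def Ψ (u : Euc n → Euc m) (Du : Euc n → Grad n m) (w : Euc n → Euc m) : ℝ :=
  (∫ x in P.Ω, P.f x (u x) (Du x)) + ∫ x, P.g x (w x) ∂(surfaceMeasure P.Ω)

/-- `u ∈ W^{1,p}(Ω; ℝᵐ)`, with weak gradient `Du` and trace `w`, satisfies the constraints. -/
structure Admissible (u : Euc n → Euc m) (Du : Euc n → Grad n m) (w : Euc n → Euc m) :
    Prop where
  isSobolev : IsSobolev P.Ω P.p u Du
  isTrace : IsTrace P.Ω P.p u Du w
  integral_constraint :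
    (∫ x in P.Ω, P.a x (u x) (Du x)) + ∫ x, P.b x (w x) ∂(surfaceMeasure P.Ω) = 0
  bulk_constraint : ∀ᵐ x ∂(volume.restrict P.Ω), P.c x (u x) (Du x) = 0
  boundary_constraint : ∀ᵐ x ∂(surfaceMeasure P.Ω), P.d x (w x) = 0

/-- The optimal value `F*`, an extended real number. -/
noncomputable def optimalValue : EReal :=
  ⨅ (u : Euc n → Euc m) (Du : Euc n → Grad n m) (w : Euc n → Euc m)
    (_ : P.Admissible u Du w), ((P.Ψ u Du w : ℝ) : EReal)

/-- The derivative of `φ` on `Ω̄ × ℝᵐ` (one-sided at boundary points). -/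
noncomputable def dφ (φ : Euc n × Euc m → Euc n) (x : Euc n) (y : Euc m) :
    Euc n × Euc m →L[ℝ] Euc n :=
  fderivWithin ℝ φ (closure P.Ω ×ˢ univ) (x, y)

/-- The partial derivative `∂φᵢ/∂xₖ (x, y)`. -/
noncomputable def partialX (φ : Euc n × Euc m → Euc n) (i k : Fin n) (x : Euc n) (y : Euc m) :
    ℝ :=
  P.dφ φ x y (EuclideanSpace.single k 1, 0) i

/-- The partial derivative `∂φᵢ/∂yⱼ (x, y)`. -/
noncomputable def partialY (φ : Euc n × Euc m → Euc n) (i : Fin n) (j : Fin m) (x : Euc n)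
    (y : Euc m) : ℝ :=
  P.dφ φ x y (0, EuclideanSpace.single j 1) i

/-- The space `Φ_p` of `C¹` fields `φ : Ω̄ × ℝᵐ → ℝⁿ` with the growth conditions. -/
structure MemΦ (φ : Euc n × Euc m → Euc n) : Prop where
  contDiffOn : ContDiffOn ℝ 1 φ (closure P.Ω ×ˢ univ)
  growth_y : ∃ C : ℝ, ∀ x ∈ closure P.Ω, ∀ y : Euc m,
    ∑ i, ∑ j, |P.partialY φ i j x y| ≤ C * (1 + ‖y‖ ^ (P.p - 1))
  growth_x : ∃ C : ℝ, ∀ x ∈ closure P.Ω, ∀ y : Euc m,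
    (∑ i, |φ (x, y) i|) + ∑ i, |P.partialX φ i i x y| ≤ C * (1 + ‖y‖ ^ P.p)

/-- The total divergence `𝒟φ(x,y,z) = ∑ᵢ ∂φᵢ/∂xᵢ + ∑ᵢ ∑ⱼ ∂φᵢ/∂yⱼ z_{ji}`. -/
noncomputable def totalDiv (φ : Euc n × Euc m → Euc n) (x : Euc n) (y : Euc m)
    (z : Grad n m) : ℝ :=
  (∑ i, P.partialX φ i i x y) + ∑ i, ∑ j, P.partialY φ i j x y * matEntry z j i

/-- `F^{φ,η,h}(x,y,z) = f(x,y,z) + 𝒟φ(x,y,z) - η a(x,y,z) - h(x)`. -/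
noncomputable def bigF (φ : Euc n × Euc m → Euc n) (η : ℝ) (h : Euc n → ℝ)
    (x : Euc n) (y : Euc m) (z : Grad n m) : ℝ :=
  P.f x y z + P.totalDiv φ x y z - η * P.a x y z - h x

/-- `G^{φ,η,ℓ}(x,y) = g(x,y) - φ(x,y) · n̂(x) - η b(x,y) - ℓ(x)`. -/
noncomputable def bigG (φ : Euc n × Euc m → Euc n) (η : ℝ) (l : Euc n → ℝ)
    (x : Euc n) (y : Euc m) : ℝ :=
  P.g x y - ⟪φ (x, y), outwardNormal P.Ω x⟫ - η * P.b x y - l x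

/-- The set `Γ ⊆ Ω̄ × ℝᵐ × ℝ^{m × n}` where `c = 0`. -/
def Γ : Set (Euc n × Euc m × Grad n m) :=
  {q | q.1 ∈ closure P.Ω ∧ P.c q.1 q.2.1 q.2.2 = 0}

/-- The set `Λ ⊆ ∂Ω × ℝᵐ` where `d = 0`. -/
def Λ : Set (Euc n × Euc m) :=
  {q | q.1 ∈ frontier P.Ω ∧ P.d q.1 q.2 = 0}

/-- The set `𝔹` of tuples `(φ, η, h, ℓ)` admissible for the pointwise dual relaxation.  The
inequality `G ≥ 0` is imposed at the points of `Λ` where `G`, i.e. the normal, is defined. -/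
structure MemB (φ : Euc n × Euc m → Euc n) (η : ℝ) (h l : Euc n → ℝ) : Prop where
  memΦ : P.MemΦ φ
  h_cont : ContinuousOn h (closure P.Ω)
  l_cont : ContinuousOn l (frontier P.Ω)
  F_nonneg : ∀ q ∈ P.Γ, 0 ≤ P.bigF φ η h q.1 q.2.1 q.2.2
  G_nonneg : ∀ q ∈ P.Λ, q.1 ∈ regularBoundary P.Ω → 0 ≤ P.bigG φ η l q.1 q.2

/-- The dual objective `∫_Ω h dx + ∫_{∂Ω} ℓ dS`. -/
noncomputable def dualObjective (h l : Euc n → ℝ) : ℝ :=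
  (∫ x in P.Ω, h x) + ∫ x, l x ∂(surfaceMeasure P.Ω)

/-- The optimal value `L_pdr` of the pointwise dual relaxation, an extended real number. -/
noncomputable def dualValue : EReal :=
  ⨆ (φ : Euc n × Euc m → Euc n) (η : ℝ) (h : Euc n → ℝ) (l : Euc n → ℝ)
    (_ : P.MemB φ η h l), ((P.dualObjective h l : ℝ) : EReal)

end VariationalProblem

/-!
The total divergence of `φ` along `(u, ∇u)` is the divergence of the vector field
`x ↦ φ (x, u x)`, so by the divergence theorem its integral cancels the flux of `φ` through the
boundary, and `∫ F + ∫ G` is the gap `Ψ u - (∫ h + ∫ ℓ)`. As `F` and `G` are nonnegative along an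
admissible `u`, Markov's inequality applied to both terms gives the bound.

For `u` smooth near `closure Ω`, the divergence theorem is localised by a partition of unity to
graph charts, where the boundary is a Lipschitz graph. Fubini's theorem along the direction of the
chart handles the vertical component. A tangential component integrates to zero over each sheared
layer above the graph, and the area formula for Lipschitz graphs converts the resulting integral
over the base into surface measure. A Sobolev function is the limit of such smooth maps, and the
growth bounds in the definition of `Φ_p` make both sides of the identity converge, by dominated
convergence along almost everywhere convergent subsequences.
-/

section AreaFormula

open scoped NNReal

theorem euclideanHausdorffMeasure_image_le_of_dist_le {X Y Z : Type*} [MetricSpace Y]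
    [MeasurableSpace Y] [BorelSpace Y] [MetricSpace Z] [MeasurableSpace Z] [BorelSpace Z]
    {A : X → Y} {f : X → Z} {t : Set X} {K : ℝ≥0}
    (h : ∀ x ∈ t, ∀ y ∈ t, dist (f x) (f y) ≤ K * dist (A x) (A y)) (d : ℕ) :
    μHE[d] (f '' t) ≤ (K : ℝ≥0∞) ^ d * μHE[d] (A '' t) := by
  rcases t.eq_empty_or_nonempty with rfl | ⟨x₀, -⟩
  · simp
  have : Nonempty X := ⟨x₀⟩
  set g : Y → Z := f ∘ Function.invFunOn A t
  have hmem : ∀ x ∈ t, Function.invFunOn A t (A x) ∈ t := fun x hx =>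
    Function.invFunOn_mem (mem_image_of_mem A hx)
  have hinv : ∀ x ∈ t, A (Function.invFunOn A t (A x)) = A x := fun x hx =>
    Function.invFunOn_eq (mem_image_of_mem A hx)
  have hg : LipschitzOnWith K g (A '' t) := by
    refine LipschitzOnWith.of_dist_le_mul ?_
    rintro _ ⟨x, hx, rfl⟩ _ ⟨y, hy, rfl⟩
    have hxy := h _ (hmem x hx) _ (hmem y hy)
    rwa [hinv x hx, hinv y hy] at hxy
  have himage : f '' t = g '' (A '' t) := by
    rw [image_image]
    refine image_congr fun x hx => dist_le_zero.1 ?_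
    have hx' := h x hx _ (hmem x hx)
    rwa [hinv x hx, dist_self, mul_zero] at hx'
  have hH := hg.hausdorffMeasure_image_le (d := d) d.cast_nonneg
  rw [ENNReal.rpow_natCast] at hH
  simp only [himage, Measure.euclideanHausdorffMeasure_def, Measure.smul_apply, ENNReal.smul_def,
    smul_eq_mul]
  rw [mul_left_comm]
  gcongr

variable {E F : Type*} [NormedAddCommGroup E] [InnerProductSpace ℝ E] [FiniteDimensional ℝ E]
  [NormedAddCommGroup F] [InnerProductSpace ℝ F]

theorem continuous_normDet [CompleteSpace F] :
    Continuous fun L : E →L[ℝ] F => (L : E →ₗ[ℝ] F).normDet := by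
  have hsqrt : (fun L : E →L[ℝ] F => (L : E →ₗ[ℝ] F).normDet) =
      fun L => √(L.adjoint ∘L L).det := by
    ext L
    rw [← L.normDet_sq, RCLike.ofReal_real_eq_id, id, Real.sqrt_sq (LinearMap.normDet_nonneg _)]
  rw [hsqrt]
  refine Real.continuous_sqrt.comp (ContinuousLinearMap.continuous_det.comp ?_)
  exact (ContinuousLinearMap.adjoint.continuous).clm_comp continuous_id

theorem exists_forall_approximatesLinearOn_dist_le {A : E →L[ℝ] F} (hA : Function.Injective A)
    {q : ℝ≥0} (hq : 1 < q) : ∃ r : ℝ≥0, r ≠ 0 ∧ ∀ (f : E → F) (t : Set E),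
      ApproximatesLinearOn f A t r → ∀ x ∈ t, ∀ y ∈ t,
        dist (f x) (f y) ≤ q * dist (A x) (A y) ∧ dist (A x) (A y) ≤ q * dist (f x) (f y) := by
  obtain ⟨K, hK, hKA⟩ := A.toLinearMap.exists_antilipschitzWith (LinearMap.ker_eq_bot.2 hA)
  have hq' : 0 < 1 - q⁻¹ := tsub_pos_of_lt (inv_lt_one_of_one_lt₀ hq)
  refine ⟨(1 - q⁻¹) / K, (div_pos hq' hK).ne', fun f t hf x hx y hy => ?_⟩
  have hsub : ‖f x - f y - (A x - A y)‖ ≤ (1 - (q : ℝ)⁻¹) * ‖A x - A y‖ := by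
    calc ‖f x - f y - (A x - A y)‖ ≤ ((1 - q⁻¹) / K : ℝ≥0) * ‖x - y‖ := by
          simpa only [map_sub] using hf x hx y hy
      _ ≤ ((1 - q⁻¹) / K : ℝ≥0) * (K * ‖A x - A y‖) := by
          gcongr
          exact (dist_eq_norm x y ▸ dist_eq_norm (A x) (A y) ▸ hKA.le_mul_dist x y :)
      _ = (1 - (q : ℝ)⁻¹) * ‖A x - A y‖ := by
          have : (K : ℝ) ≠ 0 := by exact_mod_cast hK.ne'
          rw [NNReal.coe_div, NNReal.coe_sub (inv_le_one_of_one_le₀ hq.le), NNReal.coe_one,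
            NNReal.coe_inv]
          field_simp
  have hq₁ : (1 : ℝ) < q := by exact_mod_cast hq
  have hqq : (2 - (q : ℝ)⁻¹) ≤ q := by
    have := mul_inv_cancel₀ (zero_lt_one.trans hq₁).ne'
    nlinarith [sq_nonneg ((q : ℝ) - 1)]
  have h₁ := norm_sub_norm_le (f x - f y) (A x - A y)
  have h₂ := norm_sub_norm_le (A x - A y) (f x - f y)
  rw [norm_sub_rev (A x - A y)] at h₂
  rw [dist_eq_norm, dist_eq_norm]
  refine ⟨by nlinarith [norm_nonneg (A x - A y)], ?_⟩
  rw [← inv_mul_le_iff₀ (zero_lt_one.trans hq₁)]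
  linarith

variable [MeasurableSpace E] [BorelSpace E] [MeasurableSpace F] [BorelSpace F]

theorem measure_image_iUnion_comparable {X Y ι : Type*} [Countable ι] [MeasurableSpace X]
    [MeasurableSpace Y] {ν : Measure X} {μ : Measure Y} {f : X → Y} {T : ι → Set X}
    (hT : ∀ i, MeasurableSet (T i)) (hd : Pairwise (Function.onFun Disjoint T))
    (hinj : InjOn f (⋃ i, T i)) (hm : ∀ i, MeasurableSet (f '' T i)) {J : X → ℝ≥0∞} {c : ℝ≥0∞}
    (h : ∀ i, μ (f '' T i) ≤ c * ∫⁻ x in T i, J x ∂ν ∧ ∫⁻ x in T i, J x ∂ν ≤ c * μ (f '' T i)) :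
    μ (f '' ⋃ i, T i) ≤ c * ∫⁻ x in ⋃ i, T i, J x ∂ν ∧
      ∫⁻ x in ⋃ i, T i, J x ∂ν ≤ c * μ (f '' ⋃ i, T i) := by
  have hμ : μ (f '' ⋃ i, T i) = ∑' i, μ (f '' T i) := by
    rw [image_iUnion, measure_iUnion (fun i j hij => ?_) hm]
    exact (hd hij).image hinj (subset_iUnion T i) (subset_iUnion T j)
  rw [hμ, lintegral_iUnion hT hd, ← ENNReal.tsum_mul_left, ← ENNReal.tsum_mul_left]
  exact ⟨ENNReal.tsum_le_tsum fun i => (h i).1, ENNReal.tsum_le_tsum fun i => (h i).2⟩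

theorem measure_image_comparable_of_dist_le {f : E → F} {q : ℝ≥0} {A : E →L[ℝ] F}
    {t : Set E} (ht : MeasurableSet t) (hdist : ∀ x ∈ t, ∀ y ∈ t,
      dist (f x) (f y) ≤ q * dist (A x) (A y) ∧ dist (A x) (A y) ≤ q * dist (f x) (f y))
    {J : E → ℝ} (hJ : ∀ x ∈ t, (A : E →ₗ[ℝ] F).normDet ≤ q * J x ∧
      J x ≤ q * (A : E →ₗ[ℝ] F).normDet) {d : ℕ} (hd : Module.finrank ℝ E = d) :
    μHE[d] (f '' t) ≤ (q : ℝ≥0∞) ^ (d + 1) * ∫⁻ x in t, ENNReal.ofReal (J x) ∧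
    ∫⁻ x in t, ENNReal.ofReal (J x) ≤ (q : ℝ≥0∞) ^ (d + 1) * μHE[d] (f '' t) := by
  have hA : μHE[d] (A '' t) = ∫⁻ _ in t, ENNReal.ofReal (A : E →ₗ[ℝ] F).normDet := by
    rw [← hd, setLIntegral_const]
    exact (A : E →ₗ[ℝ] F).euclideanHausdorffMeasure_image_eq_normDet_mul_volume t
  have hofReal {a b : ℝ} (hab : a ≤ q * b) : ENNReal.ofReal a ≤ q * ENNReal.ofReal b :=
    (ENNReal.ofReal_le_ofReal hab).trans_eq (ENNReal.ofReal_mul q.coe_nonneg |>.trans (by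
      rw [ENNReal.ofReal_coe_nnreal]))
  constructor
  · calc μHE[d] (f '' t) ≤ (q : ℝ≥0∞) ^ d * μHE[d] (A '' t) :=
          euclideanHausdorffMeasure_image_le_of_dist_le (fun x hx y hy => (hdist x hx y hy).1) d
      _ ≤ (q : ℝ≥0∞) ^ d * ∫⁻ x in t, q * ENNReal.ofReal (J x) := by
          rw [hA]
          gcongr 1
          exact setLIntegral_mono' ht fun x hx => hofReal (hJ x hx).1
      _ = (q : ℝ≥0∞) ^ (d + 1) * ∫⁻ x in t, ENNReal.ofReal (J x) := by
          rw [lintegral_const_mul' _ _ ENNReal.coe_ne_top, pow_succ, mul_assoc]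
  · calc ∫⁻ x in t, ENNReal.ofReal (J x)
        ≤ ∫⁻ _ in t, q * ENNReal.ofReal (A : E →ₗ[ℝ] F).normDet :=
          setLIntegral_mono' ht fun x hx => hofReal (hJ x hx).2
      _ = q * μHE[d] (A '' t) := by rw [lintegral_const_mul' _ _ ENNReal.coe_ne_top, hA]
      _ ≤ q * ((q : ℝ≥0∞) ^ d * μHE[d] (f '' t)) := by
          gcongr
          exact euclideanHausdorffMeasure_image_le_of_dist_le
            (fun x hx y hy => (hdist x hx y hy).2) d
      _ = (q : ℝ≥0∞) ^ (d + 1) * μHE[d] (f '' t) := by rw [pow_succ', mul_assoc]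

variable [SecondCountableTopology F] {f : E → F} {s : Set E}

theorem measure_image_comparable_of_normDet_le {q : ℝ≥0} (hq : 1 < q) (hs : MeasurableSet s)
    (hf : ∀ x ∈ s, DifferentiableAt ℝ f x) (hf' : ∀ x ∈ s, Function.Injective (fderiv ℝ f x))
    (hinj : InjOn f s) (hJ : ∀ x ∈ s, ∀ y ∈ s,
      (fderiv ℝ f x : E →ₗ[ℝ] F).normDet ≤ q * (fderiv ℝ f y : E →ₗ[ℝ] F).normDet) {d : ℕ}
    (hd : Module.finrank ℝ E = d) :
    μHE[d] (f '' s) ≤ (q : ℝ≥0∞) ^ (d + 1) *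
        ∫⁻ x in s, ENNReal.ofReal (fderiv ℝ f x : E →ₗ[ℝ] F).normDet ∧
      ∫⁻ x in s, ENNReal.ofReal (fderiv ℝ f x : E →ₗ[ℝ] F).normDet ≤
        (q : ℝ≥0∞) ^ (d + 1) * μHE[d] (f '' s) := by
  rcases s.eq_empty_or_nonempty with rfl | hne
  · simp
  have hr : ∀ A : E →L[ℝ] F, ∃ r : ℝ≥0, r ≠ 0 ∧ (Function.Injective A → ∀ t,
      ApproximatesLinearOn f A t r → ∀ x ∈ t, ∀ y ∈ t,
        dist (f x) (f y) ≤ q * dist (A x) (A y) ∧ dist (A x) (A y) ≤ q * dist (f x) (f y)) := by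
    intro A
    by_cases hA : Function.Injective A
    · obtain ⟨r, hr₀, hr⟩ := exists_forall_approximatesLinearOn_dist_le hA hq
      exact ⟨r, hr₀, fun _ => hr f⟩
    · exact ⟨1, one_ne_zero, fun h => absurd h hA⟩
  choose r hr₀ hr using hr
  obtain ⟨t, A, htd, htm, hst, happ, hA⟩ :=
    exists_partition_approximatesLinearOn_of_hasFDerivWithinAt f s (fderiv ℝ f)
      (fun x hx => (hf x hx).hasFDerivAt.hasFDerivWithinAt) r hr₀
  have hcover : ⋃ n, s ∩ t n = s := by rw [← inter_iUnion, inter_eq_left.2 hst]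
  have hmeas : ∀ n, MeasurableSet (s ∩ t n) := fun n => hs.inter (htm n)
  have hcomparable := measure_image_iUnion_comparable (μ := μHE[d]) (ν := volume) (f := f) hmeas
    (fun i j hij => (htd hij).mono inter_subset_right inter_subset_right) (hcover.symm ▸ hinj)
    (fun n => (hmeas n).image_of_continuousOn_injOn
      (fun x hx => (hf x hx.1).continuousAt.continuousWithinAt) (hinj.mono inter_subset_left))
    (J := fun x => ENNReal.ofReal (fderiv ℝ f x : E →ₗ[ℝ] F).normDet) (c := q ^ (d + 1))
    fun n => by
      obtain ⟨y, hy, hAy⟩ := hA hne n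
      exact measure_image_comparable_of_dist_le (hmeas n)
        (hr (A n) (hAy ▸ hf' y hy) _ (happ n))
        (fun x hx => hAy ▸ ⟨hJ y hy x hx.1, hJ x hx.1 y hy⟩) hd
  rwa [hcover] at hcomparable

variable [CompleteSpace F]

theorem measure_image_comparable_normDet_fderiv {q : ℝ≥0} (hq : 1 < q) (hs : MeasurableSet s)
    (hf : ∀ x ∈ s, DifferentiableAt ℝ f x) (hf' : ∀ x ∈ s, Function.Injective (fderiv ℝ f x))
    (hinj : InjOn f s) {d : ℕ} (hd : Module.finrank ℝ E = d) :
    μHE[d] (f '' s) ≤ (q : ℝ≥0∞) ^ (d + 1) *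
        ∫⁻ x in s, ENNReal.ofReal (fderiv ℝ f x : E →ₗ[ℝ] F).normDet ∧
      ∫⁻ x in s, ENNReal.ofReal (fderiv ℝ f x : E →ₗ[ℝ] F).normDet ≤
        (q : ℝ≥0∞) ^ (d + 1) * μHE[d] (f '' s) := by
  let J : E → ℝ := fun x => (fderiv ℝ f x : E →ₗ[ℝ] F).normDet
  let T : ℤ → Set E := fun k => s ∩ {x | ⌊Real.log (J x) / Real.log q⌋ = k}
  have hJm : Measurable J := continuous_normDet.measurable.comp (measurable_fderiv ℝ f)
  have hcover : ⋃ k, T k = s := by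
    ext x
    simp only [T, mem_iUnion, mem_inter_iff, mem_ofPred_eq, exists_and_left, exists_eq', and_true]
  have hmeas : ∀ k, MeasurableSet (T k) := fun k => hs.inter
    (((Real.measurable_log.comp hJm).div_const _).floor (measurableSet_singleton k))
  have hsub : ∀ {k x}, x ∈ T k → x ∈ s := fun hx => hx.1
  have hJpos : ∀ x ∈ s, 0 < J x := fun x hx =>
    (LinearMap.normDet_nonneg _).lt_of_ne' fun h =>
      LinearMap.normDet_eq_zero_iff_ker_ne_bot.1 h (LinearMap.ker_eq_bot.2 (hf' x hx))
  have hlog : 0 < Real.log q := Real.log_pos (by exact_mod_cast hq)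
  have hJ : ∀ k, ∀ x ∈ T k, ∀ y ∈ T k, J x ≤ q * J y := fun k x hx y hy => by
    have hx₁ := Int.lt_floor_add_one (Real.log (J x) / Real.log q)
    have hy₁ := Int.floor_le (Real.log (J y) / Real.log q)
    rw [hx.2, div_lt_iff₀ hlog] at hx₁
    rw [hy.2, le_div_iff₀ hlog] at hy₁
    rw [← Real.log_le_log_iff (hJpos x hx.1) (mul_pos (by positivity) (hJpos y hy.1)),
      Real.log_mul (by positivity) (hJpos y hy.1).ne']
    linarith
  have hcomparable := measure_image_iUnion_comparable (μ := μHE[d]) (ν := volume) (f := f) hmeas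
    (fun i j hij => Set.disjoint_left.2 fun x hi hj => hij (hi.2.symm.trans hj.2))
    (hcover.symm ▸ hinj)
    (fun k => (hmeas k).image_of_continuousOn_injOn
      (fun x hx => (hf x hx.1).continuousAt.continuousWithinAt) (hinj.mono fun _ => hsub))
    fun k => measure_image_comparable_of_normDet_le hq (hmeas k) (fun x hx => hf x (hsub hx))
      (fun x hx => hf' x (hsub hx)) (hinj.mono fun _ => hsub) (hJ k) hd
  rwa [hcover] at hcomparable

theorem euclideanHausdorffMeasure_image_eq_lintegral_normDet (hs : MeasurableSet s)
    (hf : ∀ x ∈ s, DifferentiableAt ℝ f x) (hf' : ∀ x ∈ s, Function.Injective (fderiv ℝ f x))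
    (hinj : InjOn f s) :
    μHE[Module.finrank ℝ E] (f '' s) =
      ∫⁻ x in s, ENNReal.ofReal (fderiv ℝ f x : E →ₗ[ℝ] F).normDet := by
  set d := Module.finrank ℝ E with hd
  have hlim (a : ℝ≥0∞) :
      Tendsto (fun q : ℝ≥0 => (q : ℝ≥0∞) ^ (d + 1) * a) (𝓝[>] 1) (𝓝 a) := by
    have hpow : Tendsto (fun q : ℝ≥0 => (q : ℝ≥0∞) ^ (d + 1)) (𝓝[>] 1) (𝓝 1) := by
      have := (((ENNReal.continuous_pow (d + 1)).comp ENNReal.continuous_coe).tendsto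
        (1 : ℝ≥0)).mono_left (nhdsWithin_le_nhds (s := Ioi 1))
      rwa [Function.comp_apply, ENNReal.coe_one, one_pow] at this
    simpa only [one_mul] using ENNReal.Tendsto.mul_const hpow (Or.inl one_ne_zero)
  refine le_antisymm (ge_of_tendsto (hlim _) ?_) (ge_of_tendsto (hlim _) ?_)
  · filter_upwards [self_mem_nhdsWithin] with q hq
    exact (measure_image_comparable_normDet_fderiv hq hs hf hf' hinj hd).1
  · filter_upwards [self_mem_nhdsWithin] with q hq
    exact (measure_image_comparable_normDet_fderiv hq hs hf hf' hinj hd).2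

end AreaFormula

section Graph

variable {E : Type*} [NormedAddCommGroup E] [InnerProductSpace ℝ E] {e : E} {γ : E → ℝ}

theorem inner_orthogonal_span_right (y : (ℝ ∙ e)ᗮ) : ⟪(y : E), e⟫ = 0 := by
  rw [real_inner_comm]
  exact Submodule.mem_orthogonal_singleton_iff_inner_right.1 y.2

theorem inner_orthogonal_add_smul (he : ‖e‖ = 1) (y : (ℝ ∙ e)ᗮ) (s : ℝ) :
    ⟪(y : E) + s • e, e⟫ = s := by
  rw [inner_add_left, inner_orthogonal_span_right, real_inner_smul_left,
    real_inner_self_eq_norm_sq, he, one_pow, mul_one, zero_add]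

theorem exists_eq_orthogonal_add_smul (he : ‖e‖ = 1) (x : E) :
    ∃ y : (ℝ ∙ e)ᗮ, x = y + ⟪x, e⟫ • e := by
  refine ⟨⟨x - ⟪x, e⟫ • e, ?_⟩, (sub_add_cancel _ _).symm⟩
  rw [Submodule.mem_orthogonal_singleton_iff_inner_right, inner_sub_right, inner_smul_right,
    real_inner_self_eq_norm_sq, he, real_inner_comm, one_pow, mul_one, sub_self]

theorem norm_le_norm_orthogonal_add_smul (y : (ℝ ∙ e)ᗮ) (s : ℝ) : ‖y‖ ≤ ‖(y : E) + s • e‖ := by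
  have h : ‖(y : E) + s • e‖ ^ 2 = ‖y‖ ^ 2 + ‖s • e‖ ^ 2 := by
    rw [norm_add_sq_real, inner_smul_right, inner_orthogonal_span_right, mul_zero, mul_zero,
      add_zero, Submodule.coe_norm]
  exact le_of_sq_le_sq (h ▸ le_add_of_nonneg_right (sq_nonneg _)) (norm_nonneg _)

/-- The parametrization of the graph in direction `e` of a function `γ`, over the orthogonal
complement of `e`. -/
def graphMap (e : E) (γ : E → ℝ) (y : (ℝ ∙ e)ᗮ) : E := y + γ y • e

/-- The unit vector `e` and the function `γ` describe a Lipschitz graph `{x | γ x = ⟪x, e⟫}`. As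
in `IsLipschitzDomain`, a function of the variables orthogonal to `e` is encoded as a function on
the whole space that is constant along `e`. -/
structure IsLipschitzGraph (e : E) (γ : E → ℝ) : Prop where
  norm_eq : ‖e‖ = 1
  lipschitz : ∃ K, LipschitzWith K γ
  invariant : ∀ (x : E) (t : ℝ), γ (x + t • e) = γ x

theorem inner_graphMap (he : ‖e‖ = 1) (y : (ℝ ∙ e)ᗮ) : ⟪graphMap e γ y, e⟫ = γ y :=
  inner_orthogonal_add_smul he y _

theorem graphMap_injective (he : ‖e‖ = 1) : Function.Injective (graphMap e γ) := by
  intro y y' h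
  have hγ := congrArg (⟪·, e⟫) h
  simp only [inner_graphMap he] at hγ
  simp only [graphMap, hγ, add_left_inj] at h
  exact Subtype.ext h

theorem hasFDerivAt_graphMap {y : (ℝ ∙ e)ᗮ} (hd : DifferentiableAt ℝ γ y) :
    HasFDerivAt (graphMap e γ)
      ((ℝ ∙ e)ᗮ.subtypeL + ((fderiv ℝ γ y).comp (ℝ ∙ e)ᗮ.subtypeL).smulRight e) y := by
  have hcoe : HasFDerivAt (fun y : (ℝ ∙ e)ᗮ => (y : E)) (ℝ ∙ e)ᗮ.subtypeL y :=
    (ℝ ∙ e)ᗮ.subtypeL.hasFDerivAt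
  exact hcoe.add ((hd.hasFDerivAt.comp y hcoe).smul_const e)

section Invariant

variable (hγ : ∀ (x : E) (t : ℝ), γ (x + t • e) = γ x)
include hγ

theorem hasFDerivAt_add_smul_iff {x : E} {t : ℝ} {L : E →L[ℝ] ℝ} :
    HasFDerivAt γ L (x + t • e) ↔ HasFDerivAt γ L x := by
  rw [← hasFDerivAt_comp_add_right (t • e), funext fun z => hγ z t]

theorem differentiableAt_add_smul_iff {x : E} {t : ℝ} :
    DifferentiableAt ℝ γ (x + t • e) ↔ DifferentiableAt ℝ γ x :=
  exists_congr fun _ => hasFDerivAt_add_smul_iff hγ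

theorem fderiv_add_smul (x : E) (t : ℝ) : fderiv ℝ γ (x + t • e) = fderiv ℝ γ x := by
  rw [← fderiv_comp_add_right (t • e), funext fun z => hγ z t]

theorem fderiv_apply_of_invariant (x : E) : fderiv ℝ γ x e = 0 := by
  by_cases h : DifferentiableAt ℝ γ x
  · have hline : HasDerivAt (fun t : ℝ => γ (x + t • e)) (fderiv ℝ γ x e) 0 :=
      h.hasFDerivAt.hasLineDerivAt e
    simp only [hγ] at hline
    exact hline.unique (hasDerivAt_const 0 (γ x))
  · rw [fderiv_zero_of_not_differentiableAt h, zero_apply]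

theorem graphMap_mem_graph (he : ‖e‖ = 1) (y : (ℝ ∙ e)ᗮ) :
    γ (graphMap e γ y) = ⟪graphMap e γ y, e⟫ := by
  rw [inner_graphMap he, graphMap, hγ]

theorem range_graphMap (he : ‖e‖ = 1) : range (graphMap e γ) = {x | γ x = ⟪x, e⟫} := by
  ext x
  constructor
  · rintro ⟨y, rfl⟩
    exact graphMap_mem_graph hγ he y
  · intro (hx : γ x = ⟪x, e⟫)
    obtain ⟨y, hy⟩ := exists_eq_orthogonal_add_smul he x
    have hγy : γ y = ⟪x, e⟫ := by rw [← hx, hy, hγ]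
    exact ⟨y, by rw [graphMap, hγy, ← hy]⟩

end Invariant

namespace IsLipschitzGraph

variable (h : IsLipschitzGraph e γ)
include h

theorem continuous : Continuous γ := h.lipschitz.choose_spec.continuous

theorem exists_lipschitzWith_graphMap : ∃ K, LipschitzWith K (graphMap e γ) := by
  obtain ⟨K, hK⟩ := h.lipschitz
  refine ⟨_, LipschitzWith.add (LipschitzWith.subtype_val _) (Kg := K)
    (LipschitzWith.of_dist_le_mul fun y y' => ?_)⟩
  rw [dist_eq_norm, ← sub_smul, norm_smul, h.norm_eq, mul_one, ← dist_eq_norm]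
  exact hK.dist_le_mul _ _

theorem continuous_graphMap : Continuous (graphMap e γ) :=
  h.exists_lipschitzWith_graphMap.choose_spec.continuous

theorem isOpen_epigraph : IsOpen {x | γ x < ⟪x, e⟫} := isOpen_lt h.continuous (by fun_prop)

theorem isClosed_epigraph : IsClosed {x | γ x ≤ ⟪x, e⟫} := isClosed_le h.continuous (by fun_prop)

end IsLipschitzGraph

variable [FiniteDimensional ℝ E]

/-- The downward normal vector `∇γ - e` to the graph of `γ` in direction `e`, whose norm is the
surface element. -/
noncomputable def graphNormal (e : E) (γ : E → ℝ) (x : E) : E := gradient γ x - e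

theorem inner_gradient (γ : E → ℝ) (x a : E) : ⟪gradient γ x, a⟫ = fderiv ℝ γ x a := by
  rw [gradient, InnerProductSpace.toDual_symm_apply]

theorem inner_graphNormal (x a : E) : ⟪graphNormal e γ x, a⟫ = fderiv ℝ γ x a - ⟪e, a⟫ := by
  rw [graphNormal, inner_sub_left, inner_gradient]

theorem norm_graphNormal_le {K : NNReal} (hγ : LipschitzWith K γ) (x : E) :
    ‖graphNormal e γ x‖ ≤ K + ‖e‖ := by
  refine (norm_sub_le _ _).trans (add_le_add_left ?_ _)
  rw [gradient, LinearIsometryEquiv.norm_map]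
  exact norm_fderiv_le_of_lipschitz ℝ hγ

theorem graphNormal_add_smul (hγ : ∀ (x : E) (t : ℝ), γ (x + t • e) = γ x) (x : E) (t : ℝ) :
    graphNormal e γ (x + t • e) = graphNormal e γ x := by
  rw [graphNormal, graphNormal, gradient, gradient, fderiv_add_smul hγ]

theorem measurable_graphNormal [MeasurableSpace E] [BorelSpace E] :
    Measurable (graphNormal e γ) :=
  ((InnerProductSpace.toDual ℝ E).symm.continuous.measurable.comp
    (measurable_fderiv ℝ γ)).sub_const e

theorem normDet_subtypeL_add_smulRight (he : ‖e‖ = 1) {g : E} (hg : ⟪g, e⟫ = 0)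
    {L : (ℝ ∙ e)ᗮ →L[ℝ] E} (hL : ∀ v, L v = v + ⟪g, (v : E)⟫ • e) :
    (L : (ℝ ∙ e)ᗮ →ₗ[ℝ] E).normDet ^ 2 = 1 + ‖g‖ ^ 2 := by
  let g' : (ℝ ∙ e)ᗮ :=
    ⟨g, by rwa [Submodule.mem_orthogonal_singleton_iff_inner_right, real_inner_comm]⟩
  have hinner (v w : (ℝ ∙ e)ᗮ) : ⟪L v, L w⟫ = ⟪v, w⟫ + ⟪g', v⟫ * ⟪g', w⟫ := by
    have hew : ⟪e, (w : E)⟫ = 0 := Submodule.mem_orthogonal_singleton_iff_inner_right.1 w.2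
    rw [hL, hL, inner_add_left, inner_add_right, inner_add_right, real_inner_smul_left,
      real_inner_smul_left, inner_smul_right, inner_smul_right, inner_orthogonal_span_right,
      hew, real_inner_self_eq_norm_sq, he, mul_zero, mul_zero, add_zero, zero_add, one_pow,
      mul_one, Submodule.coe_inner, Submodule.coe_inner, Submodule.coe_inner]
  -- `L† L = 1 + g gᵀ` is a transvection, and `det (1 + g gᵀ) = 1 + ⟪g, g⟫`.
  have htransvection : ((L.adjoint ∘L L : (ℝ ∙ e)ᗮ →L[ℝ] (ℝ ∙ e)ᗮ) : (ℝ ∙ e)ᗮ →ₗ[ℝ] (ℝ ∙ e)ᗮ) =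
      LinearMap.transvection (innerₛₗ ℝ g') g' := by
    ext1 v
    refine ext_inner_right ℝ fun w => ?_
    simp [ContinuousLinearMap.adjoint_inner_left, hinner, LinearMap.transvection.apply,
      inner_add_left, real_inner_smul_left]
  have hdet := L.normDet_sq
  rw [ContinuousLinearMap.det, htransvection, LinearMap.transvection.det] at hdet
  simpa only [RCLike.ofReal_real_eq_id, id_eq, innerₛₗ_apply_apply,
    real_inner_self_eq_norm_sq, Submodule.coe_norm, g'] using hdet

theorem measurePreserving_orthogonal_add_smul [MeasurableSpace E] [BorelSpace E] (he : ‖e‖ = 1) :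
    MeasurePreserving (fun q : (ℝ ∙ e)ᗮ × ℝ => (q.1 : E) + q.2 • e)
      (volume.prod volume) volume := by
  have hprod := ((ℝ ∙ e).measurePreserving_measurableEquivProd (0 : E)).symm
  rw [InnerProductSpace.euclideanHausdorffMeasure_eq_volume] at hprod
  have hspan : MeasurePreserving (LinearIsometryEquiv.toSpanUnitSingleton (𝕜 := ℝ) e he) :=
    LinearIsometryEquiv.measurePreserving _
  have hcomp : (fun q : (ℝ ∙ e)ᗮ × ℝ => (q.1 : E) + q.2 • e) =
      ((ℝ ∙ e).measurableEquivProd (0 : E)).symm ∘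
        Prod.map (LinearIsometryEquiv.toSpanUnitSingleton (𝕜 := ℝ) e he) id ∘ Prod.swap := by
    ext1 q
    simp [LinearIsometryEquiv.toSpanUnitSingleton_apply, add_comm]
  rw [hcomp]
  exact hprod.comp ((hspan.prod (MeasurePreserving.id volume)).comp Measure.measurePreserving_swap)

namespace IsLipschitzGraph

theorem norm_graphNormal_sq (h : IsLipschitzGraph e γ) (x : E) :
    ‖graphNormal e γ x‖ ^ 2 = 1 + ‖gradient γ x‖ ^ 2 := by
  rw [graphNormal, norm_sub_sq_real, inner_gradient, fderiv_apply_of_invariant h.invariant,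
    h.norm_eq]
  ring

theorem one_le_norm_graphNormal (h : IsLipschitzGraph e γ) (x : E) : 1 ≤ ‖graphNormal e γ x‖ := by
  have := h.norm_graphNormal_sq x
  nlinarith [norm_nonneg (graphNormal e γ x), sq_nonneg ‖gradient γ x‖]

theorem normDet_fderiv_graphMap (h : IsLipschitzGraph e γ) {y : (ℝ ∙ e)ᗮ}
    (hd : DifferentiableAt ℝ γ y) :
    (fderiv ℝ (graphMap e γ) y : (ℝ ∙ e)ᗮ →ₗ[ℝ] E).normDet = ‖graphNormal e γ y‖ := by
  refine (sq_eq_sq₀ (LinearMap.normDet_nonneg _) (norm_nonneg _)).1 ?_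
  rw [(hasFDerivAt_graphMap hd).fderiv, h.norm_graphNormal_sq]
  refine normDet_subtypeL_add_smulRight h.norm_eq ?_ fun v => ?_
  · rw [inner_gradient, fderiv_apply_of_invariant h.invariant]
  · simp

variable [MeasurableSpace E] [BorelSpace E]

theorem ae_differentiableAt (h : IsLipschitzGraph e γ) :
    ∀ᵐ y : (ℝ ∙ e)ᗮ, DifferentiableAt ℝ γ (y : E) := by
  obtain ⟨K, hK⟩ := h.lipschitz
  have hprod := (measurePreserving_orthogonal_add_smul h.norm_eq).quasiMeasurePreserving.ae
    (hK.ae_differentiableAt (μ := volume))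
  filter_upwards [Measure.ae_ae_of_ae_prod hprod] with y hy
  obtain ⟨s, hs⟩ := hy.exists
  exact (differentiableAt_add_smul_iff h.invariant).1 hs

theorem euclideanHausdorffMeasure_image_graphMap (h : IsLipschitzGraph e γ)
    {B : Set (ℝ ∙ e)ᗮ} (hB : MeasurableSet B) :
    μHE[Module.finrank ℝ (ℝ ∙ e)ᗮ] (graphMap e γ '' B) =
      ∫⁻ y in B, ENNReal.ofReal ‖graphNormal e γ y‖ := by
  let D : Set (ℝ ∙ e)ᗮ := {y | DifferentiableAt ℝ γ (y : E)}
  have hD : MeasurableSet D := measurable_subtype_coe (measurableSet_of_differentiableAt ℝ γ)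
  have hDc : volume Dᶜ = 0 := h.ae_differentiableAt
  have hnull : μHE[Module.finrank ℝ (ℝ ∙ e)ᗮ] (graphMap e γ '' Dᶜ) = 0 := by
    obtain ⟨K, hK⟩ := h.exists_lipschitzWith_graphMap
    have hle := euclideanHausdorffMeasure_image_le_of_dist_le (A := id) (t := Dᶜ)
      (fun x _ y _ => hK.dist_le_mul x y) (Module.finrank ℝ (ℝ ∙ e)ᗮ)
    rw [image_id, InnerProductSpace.euclideanHausdorffMeasure_eq_volume, hDc, mul_zero] at hle
    exact nonpos_iff_eq_zero.1 hle
  have hdiff : volume (B \ D) = 0 := measure_mono_null (fun _ hy => hy.2) hDc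
  have himage : μHE[Module.finrank ℝ (ℝ ∙ e)ᗮ] (graphMap e γ '' (B \ D)) = 0 :=
    measure_mono_null (image_mono fun _ hy => hy.2) hnull
  have hderiv : ∀ y ∈ B ∩ D,
      (fderiv ℝ (graphMap e γ) y : (ℝ ∙ e)ᗮ →ₗ[ℝ] E).normDet = ‖graphNormal e γ y‖ :=
    fun y hy => h.normDet_fderiv_graphMap hy.2
  have harea : μHE[Module.finrank ℝ (ℝ ∙ e)ᗮ] (graphMap e γ '' (B ∩ D)) =
      ∫⁻ y in B ∩ D, ENNReal.ofReal ‖graphNormal e γ y‖ := by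
    rw [euclideanHausdorffMeasure_image_eq_lintegral_normDet (hB.inter hD)
      (fun y hy => (hasFDerivAt_graphMap hy.2).differentiableAt) (fun y hy => ?_)
      (graphMap_injective h.norm_eq).injOn]
    · exact setLIntegral_congr_fun (hB.inter hD) fun y hy => congrArg ENNReal.ofReal (hderiv y hy)
    · refine LinearMap.ker_eq_bot.1 (not_not.1 (LinearMap.normDet_eq_zero_iff_ker_ne_bot.not.1 ?_))
      rw [hderiv y hy]
      exact (zero_lt_one.trans_le (h.one_le_norm_graphNormal y)).ne'
  rw [← inter_union_sdiff B D, image_union, measure_congr (union_ae_eq_left_of_ae_eq_empty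
    (ae_eq_empty.2 himage)), harea, setLIntegral_congr (union_ae_eq_left_of_ae_eq_empty
    (ae_eq_empty.2 hdiff))]

end IsLipschitzGraph

/-- The surface measure of the graph of `γ` in direction `e`, as the image under `graphMap` of the
surface element. -/
noncomputable def graphMeasure [MeasurableSpace E] [BorelSpace E] (e : E) (γ : E → ℝ) :
    Measure E :=
  ((volume : Measure (ℝ ∙ e)ᗮ).withDensity fun y => ENNReal.ofReal ‖graphNormal e γ y‖).map
    (graphMap e γ)

namespace IsLipschitzGraph

variable [MeasurableSpace E] [BorelSpace E]

theorem euclideanHausdorffMeasure_restrict_graph (h : IsLipschitzGraph e γ) :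
    (μHE[Module.finrank ℝ (ℝ ∙ e)ᗮ] : Measure E).restrict {x | γ x = ⟪x, e⟫} =
      graphMeasure e γ := by
  have hΦ : Measurable (graphMap e γ) := h.continuous_graphMap.measurable
  ext B hB
  rw [Measure.restrict_apply hB, graphMeasure, Measure.map_apply hΦ hB,
    withDensity_apply _ (hΦ hB), ← range_graphMap h.invariant h.norm_eq,
    ← image_preimage_eq_inter_range, h.euclideanHausdorffMeasure_image_graphMap (hΦ hB)]

theorem ae_graphMeasure (h : IsLipschitzGraph e γ) :
    ∀ᵐ x ∂graphMeasure e γ, DifferentiableAt ℝ γ x ∧ γ x = ⟪x, e⟫ := by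
  have hmeas : MeasurableSet {x | DifferentiableAt ℝ γ x ∧ γ x = ⟪x, e⟫} :=
    (measurableSet_of_differentiableAt ℝ γ).inter
      (measurableSet_eq_fun h.continuous.measurable (by fun_prop))
  rw [graphMeasure, ae_map_iff h.continuous_graphMap.aemeasurable hmeas]
  refine (withDensity_absolutelyContinuous _ _).ae_le ?_
  filter_upwards [h.ae_differentiableAt] with y hy
  exact ⟨(differentiableAt_add_smul_iff h.invariant).2 hy,
    graphMap_mem_graph h.invariant h.norm_eq y⟩

theorem graphMeasure_lt_top (h : IsLipschitzGraph e γ) {B : Set E} (hB : MeasurableSet B)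
    (hBb : Bornology.IsBounded B) : graphMeasure e γ B < ⊤ := by
  obtain ⟨K, hK⟩ := h.lipschitz
  obtain ⟨R, hR⟩ := hBb.subset_closedBall (0 : E)
  have hΦ : Measurable (graphMap e γ) := h.continuous_graphMap.measurable
  rw [graphMeasure, Measure.map_apply hΦ hB, withDensity_apply _ (hΦ hB)]
  calc ∫⁻ y in graphMap e γ ⁻¹' B, ENNReal.ofReal ‖graphNormal e γ y‖
      ≤ ∫⁻ _ in graphMap e γ ⁻¹' B, ENNReal.ofReal (K + ‖e‖) :=
        lintegral_mono fun _ => ENNReal.ofReal_le_ofReal (norm_graphNormal_le hK _)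
    _ ≤ ∫⁻ _ in Metric.closedBall (0 : (ℝ ∙ e)ᗮ) R, ENNReal.ofReal (K + ‖e‖) := by
        refine lintegral_mono_set fun _ hy => mem_closedBall_zero_iff.2 ?_
        exact (norm_le_norm_orthogonal_add_smul _ _).trans (mem_closedBall_zero_iff.1 (hR hy))
    _ < ⊤ := by
        rw [setLIntegral_const]
        exact ENNReal.mul_lt_top ENNReal.ofReal_lt_top measure_closedBall_lt_top

theorem integral_graphMeasure (h : IsLipschitzGraph e γ) {f : E → ℝ}
    (hf : AEStronglyMeasurable f (graphMeasure e γ)) :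
    ∫ x, f x ∂graphMeasure e γ = ∫ y : (ℝ ∙ e)ᗮ, ‖graphNormal e γ y‖ * f (graphMap e γ y) := by
  have hnorm : Measurable fun y : (ℝ ∙ e)ᗮ => ENNReal.ofReal ‖graphNormal e γ y‖ :=
    (measurable_graphNormal.comp measurable_subtype_coe).norm.ennreal_ofReal
  rw [graphMeasure, integral_map h.continuous_graphMap.aemeasurable hf,
    integral_withDensity_eq_integral_toReal_smul hnorm
      (Eventually.of_forall fun _ => ENNReal.ofReal_lt_top)]
  simp only [ENNReal.toReal_ofReal (norm_nonneg _), smul_eq_mul]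

end IsLipschitzGraph

end Graph

theorem exists_lipschitzWith_of_hasCompactSupport {X F : Type*} [PseudoMetricSpace X]
    [ProperSpace X] [NormedAddCommGroup F] {f : X → F} (hf : LocallyLipschitz f)
    (hc : HasCompactSupport f) : ∃ K, LipschitzWith K f := by
  obtain ⟨C, hC⟩ := hf.locallyLipschitzOn.exists_lipschitzOnWith_of_compact
    (hc.isCompact.cthickening (r := 1))
  obtain ⟨M, hM⟩ := hc.exists_bound_of_continuous hf.continuous
  refine ⟨max C (2 * M).toNNReal, LipschitzWith.of_dist_le_mul fun x y => ?_⟩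
  rcases le_or_gt (dist x y) 1 with hxy | hxy
  · by_cases hmem : x ∈ tsupport f ∨ y ∈ tsupport f
    · have hxy' :
          x ∈ Metric.cthickening 1 (tsupport f) ∧ y ∈ Metric.cthickening 1 (tsupport f) := by
        rcases hmem with hx | hy
        · exact ⟨Metric.self_subset_cthickening _ hx,
            Metric.mem_cthickening_of_dist_le y x 1 _ hx (dist_comm x y ▸ hxy)⟩
        · exact ⟨Metric.mem_cthickening_of_dist_le x y 1 _ hy hxy,
            Metric.self_subset_cthickening _ hy⟩
      refine (hC.dist_le_mul x hxy'.1 y hxy'.2).trans ?_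
      gcongr
      exact le_max_left _ _
    · rw [not_or] at hmem
      rw [image_eq_zero_of_notMem_tsupport hmem.1, image_eq_zero_of_notMem_tsupport hmem.2,
        dist_self]
      positivity
  · calc dist (f x) (f y) ≤ 2 * M := by
          rw [two_mul]
          exact (dist_le_norm_add_norm _ _).trans (add_le_add (hM x) (hM y))
      _ ≤ (2 * M).toNNReal * 1 := by rw [mul_one]; exact Real.le_coe_toNNReal _
      _ ≤ (max C (2 * M).toNNReal : NNReal) * dist x y := by
          gcongr
          exact le_max_right _ _

theorem integral_lineDeriv_eq_zero {E : Type*} [NormedAddCommGroup E] [NormedSpace ℝ E]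
    [FiniteDimensional ℝ E] [MeasurableSpace E] [BorelSpace E] {μ : Measure E}
    [μ.IsAddHaarMeasure] {f : E → ℝ} {K : NNReal} (hf : LipschitzWith K f)
    (hc : HasCompactSupport f) (v : E) : ∫ x, lineDeriv ℝ f x v ∂μ = 0 := by
  have hparts := (LipschitzWith.const (1 : ℝ)).integral_lineDeriv_mul_eq (μ := μ) hf hc (-v)
  simpa [lineDeriv] using hparts.symm

section BoundedFDeriv

variable {E : Type*} [NormedAddCommGroup E] [NormedSpace ℝ E]

theorem exists_eventually_norm_fderiv_le {F : Type*} [NormedAddCommGroup F] [NormedSpace ℝ F]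
    {f : E → F} {s : Set E} {x : E} (hf : ContDiffWithinAt ℝ 1 f s x) :
    ∃ M, ∀ᶠ y in 𝓝[interior s] x, ‖fderiv ℝ f y‖ ≤ M := by
  obtain ⟨u, hu, -, f', hf', hcont⟩ :=
    (contDiffWithinAt_succ_iff_hasFDerivWithinAt (n := 0) (by simp)).1 (zero_add (1 : ℕ∞ω) ▸ hf)
  have hbound : ∀ᶠ y in 𝓝[u] x, y ∈ u ∧ ‖f' y‖ < ‖f' x‖ + 1 :=
    eventually_mem_nhdsWithin.and
      (hcont.continuousWithinAt.norm.eventually (gt_mem_nhds (lt_add_one _)))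
  obtain ⟨O, hO, hxO, hOs⟩ :=
    mem_nhdsWithin.1 (nhdsWithin_mono x (subset_insert x s) (nhdsWithin_le_of_mem hu hbound))
  refine ⟨‖f' x‖ + 1, ?_⟩
  filter_upwards [self_mem_nhdsWithin, mem_nhdsWithin_of_mem_nhds (hO.mem_nhds hxO)]
    with y hys hyO
  have hyu := hOs ⟨hyO, interior_subset hys⟩
  have hu_nhds : u ∈ 𝓝 y := by
    filter_upwards [hO.mem_nhds hyO, isOpen_interior.mem_nhds hys] with z hzO hzs
      using (hOs ⟨hzO, interior_subset hzs⟩).1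
  rw [((hf' y hyu.1).hasFDerivAt hu_nhds).fderiv]
  exact hyu.2.le

/-- `V` is continuous on the closure of `U` and differentiable in `U` with bounded derivative: a
class of functions on which the divergence theorem makes sense without integrability
hypotheses. -/
structure HasBoundedFDerivOn (V : E → ℝ) (U : Set E) : Prop where
  continuousOn : ContinuousOn V (closure U)
  differentiableAt : ∀ x ∈ U, DifferentiableAt ℝ V x
  exists_bound : ∃ M, ∀ x ∈ U, ‖fderiv ℝ V x‖ ≤ M

namespace HasBoundedFDerivOn

variable {f g V : E → ℝ} {U : Set E}

theorem locallyLipschitzOn (hV : HasBoundedFDerivOn V U) (hU : IsOpen U) :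
    LocallyLipschitzOn U V := by
  obtain ⟨M, hM⟩ := hV.exists_bound
  intro x hx
  obtain ⟨r, hr, hball⟩ := Metric.isOpen_iff.1 hU x hx
  refine ⟨M.toNNReal, _, mem_nhdsWithin_of_mem_nhds (Metric.ball_mem_nhds x hr),
    (convex_ball x r).lipschitzOnWith_of_nnnorm_fderiv_le
      (fun y hy => hV.differentiableAt y (hball hy)) fun y hy => ?_⟩
  exact NNReal.le_toNNReal_of_coe_le (hM y (hball hy))

theorem integrableOn_fderiv_apply [MeasurableSpace E] [BorelSpace E] {μ : Measure E}
    (hV : HasBoundedFDerivOn V U) (hU : IsOpen U) (hfin : μ (U ∩ tsupport V) ≠ ⊤) (a : E) :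
    IntegrableOn (fun x => fderiv ℝ V x a) U μ := by
  obtain ⟨M, hM⟩ := hV.exists_bound
  have hsupport : IntegrableOn (fun x => fderiv ℝ V x a) (U ∩ tsupport V) μ := by
    refine Measure.integrableOn_of_bounded (M := M * ‖a‖) hfin
      (measurable_fderiv_apply_const ℝ V a).aestronglyMeasurable ?_
    filter_upwards [ae_restrict_mem (hU.measurableSet.inter (isClosed_tsupport V).measurableSet)]
      with x hx
    exact (fderiv ℝ V x).le_of_opNorm_le (hM x hx.1) a
  refine hsupport.of_forall_sdiff_eq_zero hU.measurableSet fun x hx => ?_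
  rw [fderiv_of_notMem_tsupport ℝ fun h => hx.2 ⟨hx.1, h⟩, zero_apply]

theorem of_contDiffOn (hU : IsOpen U) (hc : IsCompact (closure U))
    (hf : ContDiffOn ℝ 1 f (closure U)) : HasBoundedFDerivOn f U := by
  have hUint : U ⊆ interior (closure U) := interior_maximal subset_closure hU
  refine ⟨hf.continuousOn, fun x hx => (hf.contDiffAt
    (mem_interior_iff_mem_nhds.1 (hUint hx))).differentiableAt one_ne_zero, ?_⟩
  suffices H : ∃ M, ∀ x ∈ closure U ∩ U, ‖fderiv ℝ f x‖ ≤ M by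
    rwa [inter_eq_right.2 subset_closure] at H
  refine hc.induction_on (p := fun s => ∃ M, ∀ x ∈ s ∩ U, ‖fderiv ℝ f x‖ ≤ M) ⟨0, by simp⟩
    (fun s t hst ⟨M, hM⟩ => ⟨M, fun x hx => hM x ⟨hst hx.1, hx.2⟩⟩) ?_ fun x hx => ?_
  · rintro s t ⟨M, hM⟩ ⟨M', hM'⟩
    refine ⟨max M M', fun x hx => ?_⟩
    rcases hx.1 with hxs | hxt
    · exact (hM x ⟨hxs, hx.2⟩).trans (le_max_left _ _)
    · exact (hM' x ⟨hxt, hx.2⟩).trans (le_max_right _ _)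
  · obtain ⟨M, hM⟩ := exists_eventually_norm_fderiv_le (hf x hx)
    obtain ⟨O, hO, hxO, hOM⟩ := mem_nhdsWithin.1 hM
    exact ⟨O, mem_nhdsWithin_of_mem_nhds (hO.mem_nhds hxO), M,
      fun y hy => hOM ⟨hy.1, hUint hy.2⟩⟩

theorem mul (hf : HasBoundedFDerivOn f U) (hg : HasBoundedFDerivOn g U)
    (hc : IsCompact (closure U)) : HasBoundedFDerivOn (fun x => f x * g x) U := by
  obtain ⟨A, hA⟩ := hc.exists_bound_of_continuousOn hf.continuousOn
  obtain ⟨B, hB⟩ := hc.exists_bound_of_continuousOn hg.continuousOn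
  obtain ⟨M, hM⟩ := hf.exists_bound
  obtain ⟨M', hM'⟩ := hg.exists_bound
  refine ⟨hf.continuousOn.mul hg.continuousOn,
    fun x hx => (hf.differentiableAt x hx).mul (hg.differentiableAt x hx),
    A * M' + B * M, fun x hx => ?_⟩
  rw [fderiv_fun_mul (hf.differentiableAt x hx) (hg.differentiableAt x hx)]
  refine (norm_add_le _ _).trans ?_
  rw [norm_smul, norm_smul]
  have hAx := hA x (subset_closure hx)
  have hBx := hB x (subset_closure hx)
  exact add_le_add
    (mul_le_mul hAx (hM' x hx) (norm_nonneg _) ((norm_nonneg _).trans hAx))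
    (mul_le_mul hBx (hM x hx) (norm_nonneg _) ((norm_nonneg _).trans hBx))

theorem setIntegral_fderiv_eq_zero [FiniteDimensional ℝ E] [MeasurableSpace E] [BorelSpace E]
    {μ : Measure E} [μ.IsAddHaarMeasure] (hf : HasBoundedFDerivOn f U) (hc : HasCompactSupport f)
    (hfU : tsupport f ⊆ U) (a : E) : ∫ x in U, fderiv ℝ f x a ∂μ = 0 := by
  have hdiff : Differentiable ℝ f := fun x => by
    by_cases hx : x ∈ tsupport f
    · exact hf.differentiableAt x (hfU hx)
    · exact (differentiableAt_const 0).congr_of_eventuallyEq (notMem_tsupport_iff_eventuallyEq.1 hx)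
  obtain ⟨M, hM⟩ := hf.exists_bound
  have hLipschitz : LipschitzWith M.toNNReal f := by
    refine lipschitzWith_of_nnnorm_fderiv_le hdiff fun x => ?_
    by_cases hx : x ∈ tsupport f
    · exact NNReal.le_toNNReal_of_coe_le (hM x (hfU hx))
    · rw [fderiv_of_notMem_tsupport ℝ hx, nnnorm_zero]
      exact zero_le
  rw [setIntegral_eq_integral_of_forall_compl_eq_zero fun x hx => ?_,
    ← integral_lineDeriv_eq_zero (μ := μ) hLipschitz hc a]
  · exact integral_congr_ae (Eventually.of_forall fun x => (hdiff x).lineDeriv_eq_fderiv.symm)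
  · rw [fderiv_of_notMem_tsupport ℝ fun h => hx (hfU h), zero_apply]

end HasBoundedFDerivOn

theorem exists_contDiff_sum_eq_one [FiniteDimensional ℝ E] {K : Set E} (hK : IsCompact K)
    {N : E → Set E} (hN : ∀ x ∈ K, N x ∈ 𝓝 x) :
    ∃ (t : Finset E) (ψ : t → E → ℝ), (∀ i : t, (i : E) ∈ K ∧ ContDiff ℝ ∞ (ψ i) ∧
      HasCompactSupport (ψ i) ∧ tsupport (ψ i) ⊆ N i) ∧ ∀ x ∈ K, ∑ i, ψ i x = 1 := by
  have hopen (x : E) : IsOpen (interior (N x) ∩ Metric.ball x 1) :=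
    isOpen_interior.inter Metric.isOpen_ball
  obtain ⟨t, htK, ht⟩ := hK.elim_nhds_subcover (fun x => interior (N x) ∩ Metric.ball x 1)
    fun x hx => inter_mem (interior_mem_nhds.2 (hN x hx)) (Metric.ball_mem_nhds x one_pos)
  obtain ⟨ψ, hψ⟩ := SmoothPartitionOfUnity.exists_isSubordinate (modelWithCornersSelf ℝ E)
    hK.isClosed (fun i : t => interior (N i) ∩ Metric.ball (i : E) 1) (fun i => hopen i)
    fun x hx => by
      obtain ⟨i, hi, hxi⟩ := mem_iUnion₂.1 (ht hx)
      exact mem_iUnion.2 ⟨⟨i, hi⟩, hxi⟩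
  refine ⟨t, fun i => ψ i, fun i => ⟨htK i i.2, (ψ i).contMDiff.contDiff, ?_, ?_⟩, fun x hx => ?_⟩
  · exact Metric.isCompact_of_isClosed_isBounded (isClosed_tsupport _)
      (Metric.isBounded_ball.subset ((hψ i).trans inter_subset_right))
  · exact (hψ i).trans (inter_subset_left.trans interior_subset)
  · rw [← finsum_eq_sum_of_fintype]
    exact ψ.sum_eq_one hx

end BoundedFDeriv

section Epigraph

variable {E : Type*} [NormedAddCommGroup E] [InnerProductSpace ℝ E] {e : E} {γ : E → ℝ}

theorem graphMap_add_smul (y : (ℝ ∙ e)ᗮ) (s : ℝ) :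
    graphMap e γ y + s • e = y + (γ y + s) • e := by
  rw [graphMap, add_assoc, add_smul]

theorem norm_le_norm_graphMap_add_smul (y : (ℝ ∙ e)ᗮ) (s : ℝ) :
    ‖y‖ ≤ ‖graphMap e γ y + s • e‖ := by
  rw [graphMap_add_smul]
  exact norm_le_norm_orthogonal_add_smul y _

namespace IsLipschitzGraph

theorem inner_graphMap_add_smul (h : IsLipschitzGraph e γ) (y : (ℝ ∙ e)ᗮ) (s : ℝ) :
    ⟪graphMap e γ y + s • e, e⟫ = γ y + s := by
  rw [graphMap_add_smul, inner_orthogonal_add_smul h.norm_eq]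

theorem graphMap_add_smul_mem_iff (h : IsLipschitzGraph e γ) (y : (ℝ ∙ e)ᗮ) (s : ℝ) :
    graphMap e γ y + s • e ∈ {x | γ x < ⟪x, e⟫} ↔ 0 < s := by
  rw [mem_ofPred_eq, h.inner_graphMap_add_smul, graphMap_add_smul, h.invariant,
    lt_add_iff_pos_right]

theorem closure_epigraph (h : IsLipschitzGraph e γ) :
    closure {x | γ x < ⟪x, e⟫} = {x | γ x ≤ ⟪x, e⟫} := by
  have hsubset : {x | γ x < ⟪x, e⟫} ⊆ {x | γ x ≤ ⟪x, e⟫} := fun x (hx : γ x < ⟪x, e⟫) => hx.le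
  refine (closure_minimal hsubset h.isClosed_epigraph).antisymm fun x (hx : γ x ≤ ⟪x, e⟫) => ?_
  have hlim : Tendsto (fun t : ℝ => x + t • e) (𝓝[>] 0) (𝓝 x) := by
    have : Continuous fun t : ℝ => x + t • e := by fun_prop
    simpa using (this.tendsto 0).mono_left nhdsWithin_le_nhds
  refine mem_closure_of_tendsto hlim ?_
  filter_upwards [self_mem_nhdsWithin] with t (ht : 0 < t)
  rw [h.invariant, inner_add_left, real_inner_smul_left, real_inner_self_eq_norm_sq, h.norm_eq]
  linarith

section Layer

variable {V : E → ℝ}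

theorem lineDeriv_layer (h : IsLipschitzGraph e γ)
    (hV : HasBoundedFDerivOn V {x | γ x < ⟪x, e⟫}) {s : ℝ} (hs : 0 < s) {y : (ℝ ∙ e)ᗮ}
    (hd : DifferentiableAt ℝ γ (y : E)) (v : (ℝ ∙ e)ᗮ) :
    lineDeriv ℝ (fun y => V (graphMap e γ y + s • e)) y v =
      fderiv ℝ V (graphMap e γ y + s • e) v +
        fderiv ℝ γ y v * fderiv ℝ V (graphMap e γ y + s • e) e := by
  have hcomp := (hV.differentiableAt _ ((h.graphMap_add_smul_mem_iff y s).2 hs)).hasFDerivAt.comp y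
    ((hasFDerivAt_graphMap hd).add_const (s • e))
  rw [show (fun y => V (graphMap e γ y + s • e)) = V ∘ fun y => graphMap e γ y + s • e from rfl,
    (hcomp.hasLineDerivAt v).lineDeriv]
  simp

theorem integral_normal_line (h : IsLipschitzGraph e γ)
    (hV : HasBoundedFDerivOn V {x | γ x < ⟪x, e⟫}) (hc : HasCompactSupport V) (y : (ℝ ∙ e)ᗮ)
    (hint : IntegrableOn (fun s : ℝ => fderiv ℝ V (graphMap e γ y + s • e) e) (Ioi 0)) :
    ∫ s in Ioi (0 : ℝ), fderiv ℝ V (graphMap e γ y + s • e) e = -V (graphMap e γ y) := by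
  have hline (s : ℝ) : HasDerivAt (fun s : ℝ => graphMap e γ y + s • e) e s := by
    simpa using ((hasDerivAt_id s).smul_const e).const_add (graphMap e γ y)
  have hcont : ContinuousWithinAt (fun s : ℝ => V (graphMap e γ y + s • e)) (Ici 0) 0 := by
    refine ContinuousWithinAt.comp (hV.continuousOn _ ?_) (hline 0).continuousAt.continuousWithinAt
      fun s hs => ?_
    all_goals rw [h.closure_epigraph, mem_ofPred_eq, h.inner_graphMap_add_smul, graphMap_add_smul,
      h.invariant, le_add_iff_nonneg_right]
    exact hs
  have hderiv : ∀ s ∈ Ioi (0 : ℝ), HasDerivAt (fun s : ℝ => V (graphMap e γ y + s • e))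
      (fderiv ℝ V (graphMap e γ y + s • e) e) s := fun s hs =>
    (hV.differentiableAt _ ((h.graphMap_add_smul_mem_iff y s).2 hs)).hasFDerivAt.comp_hasDerivAt s
      (hline s)
  have htop : Tendsto (fun s : ℝ => V (graphMap e γ y + s • e)) atTop (𝓝 0) := by
    obtain ⟨R, hR⟩ := hc.isCompact.isBounded.subset_closedBall (0 : E)
    refine tendsto_const_nhds.congr' ?_
    filter_upwards [eventually_gt_atTop (R - γ y)] with s hs
    refine (image_eq_zero_of_notMem_tsupport fun hmem => ?_).symm
    have hnorm := mem_closedBall_zero_iff.1 (hR hmem)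
    have hinner := real_inner_le_norm (graphMap e γ y + s • e) e
    rw [h.inner_graphMap_add_smul, h.norm_eq] at hinner
    linarith
  rw [integral_Ioi_of_hasDerivAt_of_tendsto hcont hderiv hint htop, zero_smul, add_zero, zero_sub]

variable [FiniteDimensional ℝ E]

theorem exists_lipschitzWith_layer (h : IsLipschitzGraph e γ)
    (hV : HasBoundedFDerivOn V {x | γ x < ⟪x, e⟫}) (hc : HasCompactSupport V) {s : ℝ}
    (hs : 0 < s) : HasCompactSupport (fun y => V (graphMap e γ y + s • e)) ∧
      ∃ K, LipschitzWith K fun y => V (graphMap e γ y + s • e) := by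
  have hsupport : HasCompactSupport fun y => V (graphMap e γ y + s • e) := by
    obtain ⟨R, hR⟩ := hc.isCompact.isBounded.subset_closedBall (0 : E)
    refine HasCompactSupport.intro (isCompact_closedBall 0 R) fun y hy => ?_
    refine image_eq_zero_of_notMem_tsupport fun hmem => hy (mem_closedBall_zero_iff.2 ?_)
    exact (norm_le_norm_graphMap_add_smul y s).trans (mem_closedBall_zero_iff.1 (hR hmem))
  refine ⟨hsupport, exists_lipschitzWith_of_hasCompactSupport (fun y => ?_) hsupport⟩
  obtain ⟨K, hK⟩ := h.exists_lipschitzWith_graphMap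
  have hK' : LipschitzWith (K + 0) fun y => graphMap e γ y + s • e :=
    hK.add (LipschitzWith.const (s • e))
  have hmem := (h.graphMap_add_smul_mem_iff y s).2 hs
  obtain ⟨C, t, ht, hCt⟩ := hV.locallyLipschitzOn h.isOpen_epigraph hmem
  rw [h.isOpen_epigraph.nhdsWithin_eq hmem] at ht
  exact ⟨_, _, hK'.continuous.continuousAt.preimage_mem_nhds ht,
    hCt.comp hK'.lipschitzOnWith (mapsTo_preimage _ _)⟩

variable [MeasurableSpace E] [BorelSpace E]

/-- The vector `a + ⟪graphNormal e γ y, a⟫ • e` is tangent to the translates of the graph along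
`e`, and a derivative in a tangential direction has vanishing integral. -/
theorem integral_layer_tangential_eq_zero (h : IsLipschitzGraph e γ)
    (hV : HasBoundedFDerivOn V {x | γ x < ⟪x, e⟫}) (hc : HasCompactSupport V) {s : ℝ}
    (hs : 0 < s) (a : E) :
    ∫ y : (ℝ ∙ e)ᗮ, (fderiv ℝ V (graphMap e γ y + s • e) a +
      ⟪graphNormal e γ y, a⟫ * fderiv ℝ V (graphMap e γ y + s • e) e) = 0 := by
  obtain ⟨v, hv⟩ := exists_eq_orthogonal_add_smul h.norm_eq a
  obtain ⟨hsupport, K, hK⟩ := h.exists_lipschitzWith_layer hV hc hs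
  rw [← integral_lineDeriv_eq_zero (μ := volume) hK hsupport v]
  refine integral_congr_ae ?_
  filter_upwards [h.ae_differentiableAt] with y hy
  rw [h.lineDeriv_layer hV hs hy, inner_graphNormal, real_inner_comm]
  nth_rw 1 [hv]
  nth_rw 2 [hv]
  rw [map_add, map_add, map_smul, map_smul, fderiv_apply_of_invariant h.invariant, smul_eq_mul,
    smul_eq_mul]
  ring

end Layer

variable [FiniteDimensional ℝ E] [MeasurableSpace E] [BorelSpace E]

theorem measurePreserving_graphMap_add_smul (h : IsLipschitzGraph e γ) :
    MeasurePreserving (fun q : (ℝ ∙ e)ᗮ × ℝ => graphMap e γ q.1 + q.2 • e)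
      (volume.prod (volume.restrict (Ioi 0))) (volume.restrict {x | γ x < ⟪x, e⟫}) := by
  have hshear : MeasurePreserving (fun q : (ℝ ∙ e)ᗮ × ℝ => (q.1, γ q.1 + q.2))
      (volume.prod volume) (volume.prod volume) :=
    (MeasurePreserving.id volume).skew_product (g := fun (y : (ℝ ∙ e)ᗮ) (s : ℝ) => γ y + s)
      ((h.continuous.measurable.comp (measurable_subtype_coe.comp measurable_fst)).add
        measurable_snd)
      (Eventually.of_forall fun y => map_add_left_eq_self volume (γ y))
  have hmp := ((measurePreserving_orthogonal_add_smul h.norm_eq).comp hshear).restrict_preimage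
    h.isOpen_epigraph.measurableSet
  have hcomp : (fun q : (ℝ ∙ e)ᗮ × ℝ => (q.1 : E) + q.2 • e) ∘
      (fun q : (ℝ ∙ e)ᗮ × ℝ => (q.1, γ q.1 + q.2)) = fun q => graphMap e γ q.1 + q.2 • e :=
    funext fun q => (graphMap_add_smul q.1 q.2).symm
  have hpreimage : (fun q : (ℝ ∙ e)ᗮ × ℝ => graphMap e γ q.1 + q.2 • e) ⁻¹'
      {x | γ x < ⟪x, e⟫} = univ ×ˢ Ioi 0 := by
    ext q
    rw [mem_preimage, h.graphMap_add_smul_mem_iff, mem_prod, mem_Ioi]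
    exact (and_iff_right (mem_univ _)).symm
  rwa [hcomp, hpreimage, ← Measure.prod_restrict, Measure.restrict_univ] at hmp

theorem integrable_fderiv_graphMap_add_smul (h : IsLipschitzGraph e γ) {V : E → ℝ}
    (hV : HasBoundedFDerivOn V {x | γ x < ⟪x, e⟫}) (hc : HasCompactSupport V) (a : E) :
    Integrable (fun q : (ℝ ∙ e)ᗮ × ℝ => fderiv ℝ V (graphMap e γ q.1 + q.2 • e) a)
      (volume.prod (volume.restrict (Ioi 0))) :=
  h.measurePreserving_graphMap_add_smul.integrable_comp_of_integrable
    (hV.integrableOn_fderiv_apply h.isOpen_epigraph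
      (measure_ne_top_of_subset inter_subset_right hc.isCompact.measure_ne_top) a)

theorem integrable_inner_graphNormal_mul_fderiv (h : IsLipschitzGraph e γ) {V : E → ℝ}
    (hV : HasBoundedFDerivOn V {x | γ x < ⟪x, e⟫}) (hc : HasCompactSupport V) (a : E) :
    Integrable (fun q : (ℝ ∙ e)ᗮ × ℝ => ⟪graphNormal e γ q.1, a⟫ *
      fderiv ℝ V (graphMap e γ q.1 + q.2 • e) e) (volume.prod (volume.restrict (Ioi 0))) := by
  obtain ⟨K, hK⟩ := h.lipschitz
  refine (h.integrable_fderiv_graphMap_add_smul hV hc e).bdd_mul (c := (K + ‖e‖) * ‖a‖) ?_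
    (Eventually.of_forall fun q => ?_)
  · exact ((measurable_graphNormal.comp (measurable_subtype_coe.comp
      measurable_fst)).inner_const).aestronglyMeasurable
  · refine (norm_inner_le_norm _ _).trans ?_
    gcongr
    exact norm_graphNormal_le hK _

theorem setIntegral_epigraph_fderiv (h : IsLipschitzGraph e γ) {V : E → ℝ}
    (hV : HasBoundedFDerivOn V {x | γ x < ⟪x, e⟫}) (hc : HasCompactSupport V) (a : E) :
    ∫ x in {x | γ x < ⟪x, e⟫}, fderiv ℝ V x a =
      ∫ y : (ℝ ∙ e)ᗮ, V (graphMap e γ y) * ⟪graphNormal e γ y, a⟫ := by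
  have hmp := h.measurePreserving_graphMap_add_smul
  have hint (b : E) := h.integrable_fderiv_graphMap_add_smul hV hc b
  have hnormal := h.integrable_inner_graphNormal_mul_fderiv hV hc a
  have htangential : ∫ q : (ℝ ∙ e)ᗮ × ℝ, (fderiv ℝ V (graphMap e γ q.1 + q.2 • e) a +
      ⟪graphNormal e γ q.1, a⟫ * fderiv ℝ V (graphMap e γ q.1 + q.2 • e) e)
        ∂volume.prod (volume.restrict (Ioi 0)) = 0 := by
    refine (integral_prod_symm _ ((hint a).add hnormal)).trans ?_
    exact setIntegral_eq_zero_of_forall_eq_zero fun s hs =>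
      h.integral_layer_tangential_eq_zero hV hc hs a
  have hbulk : ∫ x in {x | γ x < ⟪x, e⟫}, fderiv ℝ V x a =
      ∫ q : (ℝ ∙ e)ᗮ × ℝ, fderiv ℝ V (graphMap e γ q.1 + q.2 • e) a
        ∂volume.prod (volume.restrict (Ioi 0)) := by
    rw [← hmp.map_eq, integral_map hmp.aemeasurable
      (measurable_fderiv_apply_const ℝ V a).aestronglyMeasurable]
  rw [integral_add (hint a) hnormal, ← hbulk] at htangential
  rw [eq_neg_of_add_eq_zero_left htangential, integral_prod _ hnormal, ← integral_neg]
  refine integral_congr_ae ?_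
  filter_upwards [(hint e).prod_right_ae] with y hy
  rw [integral_const_mul, h.integral_normal_line hV hc y hy]
  ring

end IsLipschitzGraph

end Epigraph

section Normal

variable {n : ℕ} {Ω : Set (Euc n)} {x ν ν' : Euc n}

theorem IsOutwardUnitNormal.unique (h : IsOutwardUnitNormal Ω x ν)
    (h' : IsOutwardUnitNormal Ω x ν') : ν = ν' := by
  -- Points `x + t • (ν - ν')` with `t > 0` small are outside `Ω` for `ν` but inside for `ν'`.
  by_contra hne
  have hv : 0 < ‖ν - ν'‖ := norm_pos_iff.2 (sub_ne_zero.2 hne)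
  have hsq : ‖ν - ν'‖ ^ 2 = 2 * (1 - ⟪ν, ν'⟫) := by
    rw [norm_sub_sq_real, h.1, h'.1]
    ring
  set c := 1 - ⟪ν, ν'⟫ with hc
  have hc0 : 0 < c := by nlinarith
  have hinner : ⟪ν - ν', ν⟫ = c := by
    rw [inner_sub_left, real_inner_self_eq_norm_sq, h.1, real_inner_comm, hc]
    ring
  have hinner' : ⟪ν - ν', ν'⟫ = -c := by
    rw [inner_sub_left, real_inner_self_eq_norm_sq, h'.1, hc]
    ring
  have hκ : 0 < c / (2 * ‖ν - ν'‖) := by positivity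
  have hlim : Tendsto (fun t : ℝ => x + t • (ν - ν')) (𝓝[>] 0) (𝓝 x) := by
    have : Continuous fun t : ℝ => x + t • (ν - ν') := by fun_prop
    simpa using (this.tendsto 0).mono_left nhdsWithin_le_nhds
  obtain ⟨t, ⟨hside, hside'⟩, ht⟩ := (((hlim.eventually (h.2 _ hκ)).and
    (hlim.eventually (h'.2 _ hκ))).and self_mem_nhdsWithin).exists
  have ht : 0 < t := ht
  have hcone : c / (2 * ‖ν - ν'‖) * ‖t • (ν - ν')‖ = t * c / 2 := by
    rw [norm_smul, Real.norm_of_nonneg ht.le]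
    field_simp
  simp only [add_sub_cancel_left, hcone, real_inner_smul_left, hinner, hinner'] at hside hside'
  have htc : 0 < t * c := by positivity
  exact hside.2 (by linarith) (hside'.1 (by linarith))

theorem IsOutwardUnitNormal.outwardNormal_eq (h : IsOutwardUnitNormal Ω x ν) :
    outwardNormal Ω x = ν := by
  have hx : ∃ ν, IsOutwardUnitNormal Ω x ν := ⟨ν, h⟩
  rw [outwardNormal, dif_pos hx]
  exact hx.choose_spec.unique h

theorem norm_outwardNormal_le : ‖outwardNormal Ω x‖ ≤ 1 := by
  rw [outwardNormal]
  split_ifs with hx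
  · exact hx.choose_spec.1.le
  · simp

end Normal

/-- In the open set `N`, the set `Ω` is the epigraph of the Lipschitz function `γ` in
direction `e`. -/
structure IsGraphChart {n : ℕ} (Ω : Set (Euc n)) (e : Euc n) (γ : Euc n → ℝ) (N : Set (Euc n)) :
    Prop extends IsLipschitzGraph e γ where
  isOpen : IsOpen N
  mem_iff : ∀ x ∈ N, (x ∈ Ω ↔ γ x < ⟪x, e⟫)

theorem IsLipschitzDomain.exists_chart {n : ℕ} {Ω : Set (Euc n)} (hΩ : IsLipschitzDomain Ω)
    {x₀ : Euc n} (hx₀ : x₀ ∈ frontier Ω) : ∃ e γ N, x₀ ∈ N ∧ IsGraphChart Ω e γ N := by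
  obtain ⟨e, γ, he, hK, hγ, hev⟩ := hΩ.graph x₀ hx₀
  obtain ⟨N, hN, hNo, hxN⟩ := eventually_nhds_iff.1 hev
  exact ⟨e, γ, N, hxN, ⟨he, hK, hγ⟩, hNo, hN⟩

section Chart

variable {n : ℕ} {Ω : Set (Euc n)} {e : Euc n} {γ : Euc n → ℝ} {N : Set (Euc n)}

theorem finrank_orthogonal_span_singleton_euc (he : e ≠ 0) :
    Module.finrank ℝ (ℝ ∙ e)ᗮ = n - 1 := by
  have hsum := (ℝ ∙ e).finrank_add_finrank_orthogonal
  rw [finrank_span_singleton he, finrank_euclideanSpace_fin] at hsum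
  omega

/-- The outward unit normal to the epigraph of `γ` in direction `e`. -/
noncomputable def graphUnitNormal (e : Euc n) (γ : Euc n → ℝ) (x : Euc n) : Euc n :=
  ‖graphNormal e γ x‖⁻¹ • graphNormal e γ x

theorem measurable_graphUnitNormal : Measurable (graphUnitNormal e γ) :=
  measurable_graphNormal.norm.inv.smul measurable_graphNormal

namespace IsGraphChart

theorem mono (h : IsGraphChart Ω e γ N) {N' : Set (Euc n)} (hN : N' ⊆ N) (hN' : IsOpen N') :
    IsGraphChart Ω e γ N' :=
  ⟨h.toIsLipschitzGraph, hN', fun x hx => h.mem_iff x (hN hx)⟩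

theorem eventually_mem_iff (h : IsGraphChart Ω e γ N) {x : Euc n} (hx : x ∈ N) :
    ∀ᶠ z in 𝓝 x, (z ∈ Ω ↔ γ z < ⟪z, e⟫) := by
  filter_upwards [h.isOpen.mem_nhds hx] with z hz using h.mem_iff z hz

theorem mem_closure_iff (h : IsGraphChart Ω e γ N) {x : Euc n} (hx : x ∈ N) :
    x ∈ closure Ω ↔ x ∈ closure {z | γ z < ⟪z, e⟫} := by
  rw [mem_closure_iff_frequently, frequently_congr (h.eventually_mem_iff hx),
    mem_closure_iff_frequently]
  rfl

theorem mem_frontier_iff (h : IsGraphChart Ω e γ N) (hΩ : IsOpen Ω) {x : Euc n} (hx : x ∈ N) :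
    x ∈ frontier Ω ↔ γ x = ⟪x, e⟫ := by
  rw [hΩ.frontier_eq, Set.mem_sdiff, h.mem_closure_iff hx, h.mem_iff x hx, h.closure_epigraph,
    mem_ofPred_eq, not_lt, le_antisymm_iff]

theorem isOutwardUnitNormal (h : IsGraphChart Ω e γ N) {x : Euc n} (hx : x ∈ N)
    (hγx : γ x = ⟪x, e⟫) (hd : DifferentiableAt ℝ γ x) :
    IsOutwardUnitNormal Ω x (graphUnitNormal e γ x) := by
  have hone := h.one_le_norm_graphNormal x
  have hpos : 0 < ‖graphNormal e γ x‖ := by linarith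
  refine ⟨?_, fun κ hκ => ?_⟩
  · rw [graphUnitNormal, norm_smul, norm_inv, norm_norm, inv_mul_cancel₀ hpos.ne']
  filter_upwards [h.eventually_mem_iff hx, hd.hasFDerivAt.isLittleO.def hκ] with y hy hlittle
  rw [Real.norm_eq_abs, abs_le] at hlittle
  have hinner : ⟪y - x, graphNormal e γ x⟫ = fderiv ℝ γ x (y - x) - (⟪y, e⟫ - ⟪x, e⟫) := by
    rw [real_inner_comm, inner_graphNormal, inner_sub_right, real_inner_comm, real_inner_comm e x]
  have hcone : κ * ‖y - x‖ ≤ κ * ‖y - x‖ * ‖graphNormal e γ x‖ :=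
    le_mul_of_one_le_right (by positivity) hone
  rw [hy, graphUnitNormal, inner_smul_right, inv_mul_lt_iff₀ hpos, lt_inv_mul_iff₀ hpos, hinner]
  constructor <;> intro hlt <;> linarith

theorem surfaceMeasure_restrict (h : IsGraphChart Ω e γ N) (hΩ : IsOpen Ω) :
    (surfaceMeasure Ω).restrict N = (graphMeasure e γ).restrict N := by
  have he : e ≠ 0 := norm_ne_zero_iff.1 (h.norm_eq ▸ one_ne_zero)
  rw [← h.euclideanHausdorffMeasure_restrict_graph, surfaceMeasure,
    finrank_orthogonal_span_singleton_euc he, Measure.restrict_restrict h.isOpen.measurableSet,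
    Measure.restrict_restrict h.isOpen.measurableSet]
  congr 1
  ext x
  exact and_congr_right fun hx => h.mem_frontier_iff hΩ hx

theorem ae_isOutwardUnitNormal (h : IsGraphChart Ω e γ N) (hΩ : IsOpen Ω) :
    ∀ᵐ x ∂(surfaceMeasure Ω).restrict N, IsOutwardUnitNormal Ω x (graphUnitNormal e γ x) := by
  rw [h.surfaceMeasure_restrict hΩ]
  filter_upwards [ae_restrict_of_ae h.ae_graphMeasure, ae_restrict_mem h.isOpen.measurableSet]
    with x hx hxN
  exact h.isOutwardUnitNormal hxN hx.2 hx.1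

theorem surfaceMeasure_lt_top (h : IsGraphChart Ω e γ N) (hΩ : IsOpen Ω)
    (hN : Bornology.IsBounded N) : surfaceMeasure Ω N < ⊤ := by
  rw [← Measure.restrict_apply_self, h.surfaceMeasure_restrict hΩ, Measure.restrict_apply_self]
  exact h.graphMeasure_lt_top h.isOpen.measurableSet hN

section Divergence

variable {V : Euc n → ℝ}

theorem hasBoundedFDerivOn_epigraph (h : IsGraphChart Ω e γ N) (hV : HasBoundedFDerivOn V Ω)
    (hVN : tsupport V ⊆ N) : HasBoundedFDerivOn V {x | γ x < ⟪x, e⟫} := by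
  refine ⟨fun x hx => ?_, fun x hx => ?_, ?_⟩
  · by_cases hxV : x ∈ tsupport V
    · have hxN := hVN hxV
      refine (hV.continuousOn x ((h.mem_closure_iff hxN).2 hx)).mono_of_mem_nhdsWithin ?_
      filter_upwards [self_mem_nhdsWithin, mem_nhdsWithin_of_mem_nhds (h.isOpen.mem_nhds hxN)]
        with z hz hzN using (h.mem_closure_iff hzN).2 hz
    · exact (continuousAt_const.congr
        (notMem_tsupport_iff_eventuallyEq.1 hxV).symm).continuousWithinAt
  · by_cases hxV : x ∈ tsupport V
    · exact hV.differentiableAt x ((h.mem_iff x (hVN hxV)).2 hx)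
    · exact (differentiableAt_const 0).congr_of_eventuallyEq
        (notMem_tsupport_iff_eventuallyEq.1 hxV)
  · obtain ⟨M, hM⟩ := hV.exists_bound
    refine ⟨max M 0, fun x hx => ?_⟩
    by_cases hxV : x ∈ tsupport V
    · exact (hM x ((h.mem_iff x (hVN hxV)).2 hx)).trans (le_max_left _ _)
    · rw [fderiv_of_notMem_tsupport ℝ hxV, norm_zero]
      exact le_max_right _ _

theorem setIntegral_fderiv_eq (h : IsGraphChart Ω e γ N) (hΩ : IsOpen Ω) (hVN : tsupport V ⊆ N)
    (a : Euc n) : ∫ x in Ω, fderiv ℝ V x a = ∫ x in {x | γ x < ⟪x, e⟫}, fderiv ℝ V x a := by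
  rw [← integral_indicator hΩ.measurableSet,
    ← integral_indicator h.isOpen_epigraph.measurableSet]
  congr 1
  ext x
  by_cases hxV : x ∈ tsupport V
  · exact indicator_eq_indicator (h.mem_iff x (hVN hxV)) rfl
  · simp [indicator, fderiv_of_notMem_tsupport ℝ hxV]

theorem surfaceIntegral_eq (h : IsGraphChart Ω e γ N) (hΩ : IsOpen Ω)
    (hV : ContinuousOn V {x | γ x = ⟪x, e⟫}) (hVN : tsupport V ⊆ N) (a : Euc n) :
    ∫ x, V x * ⟪outwardNormal Ω x, a⟫ ∂surfaceMeasure Ω =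
      ∫ y : (ℝ ∙ e)ᗮ, V (graphMap e γ y) * ⟪graphNormal e γ y, a⟫ := by
  have hzero (ν : Euc n → Euc n) (x) (hx : x ∉ N) : V x * ⟪ν x, a⟫ = 0 := by
    rw [image_eq_zero_of_notMem_tsupport fun hxV => hx (hVN hxV), zero_mul]
  have hnormal : ∀ᵐ x ∂(surfaceMeasure Ω).restrict N, V x * ⟪outwardNormal Ω x, a⟫ =
      V x * ⟪graphUnitNormal e γ x, a⟫ := by
    filter_upwards [h.ae_isOutwardUnitNormal hΩ] with x hx
    rw [hx.outwardNormal_eq]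
  have hmeas : AEStronglyMeasurable (fun x => V x * ⟪graphUnitNormal e γ x, a⟫)
      (graphMeasure e γ) := by
    refine AEStronglyMeasurable.mul ?_ measurable_graphUnitNormal.inner_const.aestronglyMeasurable
    rw [← h.euclideanHausdorffMeasure_restrict_graph]
    exact hV.aestronglyMeasurable (measurableSet_eq_fun h.continuous.measurable (by fun_prop))
  calc ∫ x, V x * ⟪outwardNormal Ω x, a⟫ ∂surfaceMeasure Ω
      = ∫ x in N, V x * ⟪outwardNormal Ω x, a⟫ ∂surfaceMeasure Ω :=
        (setIntegral_eq_integral_of_forall_compl_eq_zero (hzero _)).symm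
    _ = ∫ x, V x * ⟪graphUnitNormal e γ x, a⟫ ∂graphMeasure e γ := by
        rw [integral_congr_ae hnormal, h.surfaceMeasure_restrict hΩ,
          setIntegral_eq_integral_of_forall_compl_eq_zero (hzero _)]
    _ = ∫ y : (ℝ ∙ e)ᗮ, V (graphMap e γ y) * ⟪graphNormal e γ y, a⟫ := by
        rw [h.integral_graphMeasure hmeas]
        refine integral_congr_ae (Eventually.of_forall fun y => ?_)
        have hone := h.one_le_norm_graphNormal y
        beta_reduce
        rw [graphUnitNormal, graphMap, graphNormal_add_smul h.invariant, real_inner_smul_left]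
        field_simp

theorem setIntegral_fderiv (h : IsGraphChart Ω e γ N) (hΩ : IsOpen Ω)
    (hV : HasBoundedFDerivOn V Ω) (hc : HasCompactSupport V) (hVN : tsupport V ⊆ N) (a : Euc n) :
    ∫ x in Ω, fderiv ℝ V x a = ∫ x, V x * ⟪outwardNormal Ω x, a⟫ ∂surfaceMeasure Ω := by
  have hV' := h.hasBoundedFDerivOn_epigraph hV hVN
  have hgraph : {x | γ x = ⟪x, e⟫} ⊆ closure {x | γ x < ⟪x, e⟫} := by
    rw [h.closure_epigraph]
    exact fun x (hx : γ x = _) => show γ x ≤ _ from hx.le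
  rw [h.setIntegral_fderiv_eq hΩ hVN, h.surfaceIntegral_eq hΩ (hV'.continuousOn.mono hgraph) hVN,
    h.setIntegral_epigraph_fderiv hV' hc]

end Divergence

end IsGraphChart

end Chart

section Domain

variable {n : ℕ} {Ω : Set (Euc n)}

theorem surfaceMeasure_restrict_frontier (Ω : Set (Euc n)) :
    (surfaceMeasure Ω).restrict (frontier Ω) = surfaceMeasure Ω := by
  rw [surfaceMeasure, Measure.restrict_restrict isClosed_frontier.measurableSet, inter_self]

theorem ae_mem_frontier (Ω : Set (Euc n)) : ∀ᵐ x ∂surfaceMeasure Ω, x ∈ frontier Ω :=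
  ae_restrict_mem isClosed_frontier.measurableSet

namespace IsLipschitzDomain

theorem isCompact_closure (hΩ : IsLipschitzDomain Ω) : IsCompact (closure Ω) :=
  hΩ.isBounded.isCompact_closure

theorem isCompact_frontier (hΩ : IsLipschitzDomain Ω) : IsCompact (frontier Ω) :=
  hΩ.isCompact_closure.of_isClosed_subset isClosed_frontier frontier_subset_closure

theorem frontier_induction (hΩ : IsLipschitzDomain Ω) {p : Set (Euc n) → Prop} (hempty : p ∅)
    (hmono : ∀ ⦃s t⦄, s ⊆ t → p t → p s) (hunion : ∀ ⦃s t⦄, p s → p t → p (s ∪ t))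
    (hchart : ∀ e γ N, IsGraphChart Ω e γ N → Bornology.IsBounded N → p N) :
    p (frontier Ω) := by
  refine hΩ.isCompact_frontier.induction_on hempty hmono hunion fun x hx => ?_
  obtain ⟨e, γ, N, hxN, hN⟩ := hΩ.exists_chart hx
  refine ⟨N ∩ Metric.ball x 1, mem_nhdsWithin_of_mem_nhds (inter_mem (hN.isOpen.mem_nhds hxN)
    (Metric.ball_mem_nhds x one_pos)), ?_⟩
  exact hchart e γ _ (hN.mono inter_subset_left (hN.isOpen.inter Metric.isOpen_ball))
    (Metric.isBounded_ball.subset inter_subset_right)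

theorem isFiniteMeasure_surfaceMeasure (hΩ : IsLipschitzDomain Ω) :
    IsFiniteMeasure (surfaceMeasure Ω) := by
  refine ⟨?_⟩
  rw [← surfaceMeasure_restrict_frontier, Measure.restrict_apply_univ]
  exact hΩ.frontier_induction (p := fun s => surfaceMeasure Ω s < ⊤) (by simp)
    (fun s t hst ht => (measure_mono hst).trans_lt ht)
    (fun s t hs ht => (measure_union_le _ _).trans_lt (ENNReal.add_lt_top.2 ⟨hs, ht⟩))
    fun e γ N hN hNb => hN.surfaceMeasure_lt_top hΩ.isOpen hNb

theorem ae_mem_regularBoundary (hΩ : IsLipschitzDomain Ω) :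
    ∀ᵐ x ∂surfaceMeasure Ω, x ∈ regularBoundary Ω := by
  refine (ae_mem_frontier Ω).and ?_
  rw [← surfaceMeasure_restrict_frontier]
  refine hΩ.frontier_induction
    (p := fun s => ∀ᵐ x ∂(surfaceMeasure Ω).restrict s, ∃ ν, IsOutwardUnitNormal Ω x ν) (by simp)
    (fun s t hst ht => ae_restrict_of_ae_restrict_of_subset hst ht)
    (fun s t hs ht => (ae_restrict_union_iff _ _ _).2 ⟨hs, ht⟩) fun e γ N hN _ => ?_
  filter_upwards [hN.ae_isOutwardUnitNormal hΩ.isOpen] with x hx using ⟨_, hx⟩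

theorem aemeasurable_outwardNormal (hΩ : IsLipschitzDomain Ω) :
    AEMeasurable (outwardNormal Ω) (surfaceMeasure Ω) := by
  rw [← surfaceMeasure_restrict_frontier]
  refine hΩ.frontier_induction
    (p := fun s => AEMeasurable (outwardNormal Ω) ((surfaceMeasure Ω).restrict s)) (by simp)
    (fun s t hst ht => ht.mono_measure (Measure.restrict_mono hst le_rfl))
    (fun s t hs ht => aemeasurable_union_iff.2 ⟨hs, ht⟩) fun e γ N hN _ => ?_
  refine measurable_graphUnitNormal.aemeasurable.congr (f := graphUnitNormal e γ) ?_
  filter_upwards [hN.ae_isOutwardUnitNormal hΩ.isOpen] with x hx using hx.outwardNormal_eq.symm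

theorem integrable_mul_inner_outwardNormal (hΩ : IsLipschitzDomain Ω) {V : Euc n → ℝ}
    (hV : ContinuousOn V (frontier Ω)) (a : Euc n) :
    Integrable (fun x => V x * ⟪outwardNormal Ω x, a⟫) (surfaceMeasure Ω) := by
  have := hΩ.isFiniteMeasure_surfaceMeasure
  obtain ⟨C, hC⟩ := hΩ.isCompact_frontier.exists_bound_of_continuousOn hV
  have hbound : ∀ᵐ x ∂surfaceMeasure Ω, ‖V x‖ ≤ C := (ae_mem_frontier Ω).mono hC
  have hmeas : AEStronglyMeasurable V (surfaceMeasure Ω) :=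
    hV.aestronglyMeasurable isClosed_frontier.measurableSet
  refine Integrable.bdd_mul ?_ hmeas hbound
  refine (integrable_const ‖a‖).mono'
    hΩ.aemeasurable_outwardNormal.inner_const.aestronglyMeasurable
    (Eventually.of_forall fun x => ?_)
  exact (norm_inner_le_norm _ _).trans (mul_le_of_le_one_left (norm_nonneg a) norm_outwardNormal_le)

theorem exists_nhds_setIntegral_fderiv (hΩ : IsLipschitzDomain Ω) {x₀ : Euc n}
    (hx₀ : x₀ ∈ closure Ω) : ∃ N ∈ 𝓝 x₀, ∀ V : Euc n → ℝ, HasBoundedFDerivOn V Ω →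
      HasCompactSupport V → tsupport V ⊆ N → ∀ a, ∫ x in Ω, fderiv ℝ V x a =
        ∫ x, V x * ⟪outwardNormal Ω x, a⟫ ∂surfaceMeasure Ω := by
  by_cases hx : x₀ ∈ Ω
  · refine ⟨Ω, hΩ.isOpen.mem_nhds hx, fun V hV hc hVΩ a => ?_⟩
    rw [hV.setIntegral_fderiv_eq_zero hc hVΩ]
    refine (integral_eq_zero_of_ae ?_).symm
    filter_upwards [ae_mem_frontier Ω] with x hxΩ
    rw [hΩ.isOpen.frontier_eq] at hxΩ
    simp [image_eq_zero_of_notMem_tsupport fun h => hxΩ.2 (hVΩ h)]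
  · have hxf : x₀ ∈ frontier Ω := by
      rw [hΩ.isOpen.frontier_eq]
      exact ⟨hx₀, hx⟩
    obtain ⟨e, γ, N, hxN, hN⟩ := hΩ.exists_chart hxf
    exact ⟨N, hN.isOpen.mem_nhds hxN, fun V => hN.setIntegral_fderiv hΩ.isOpen⟩

theorem setIntegral_fderiv (hΩ : IsLipschitzDomain Ω) {V : Euc n → ℝ}
    (hV : HasBoundedFDerivOn V Ω) (a : Euc n) :
    ∫ x in Ω, fderiv ℝ V x a = ∫ x, V x * ⟪outwardNormal Ω x, a⟫ ∂surfaceMeasure Ω := by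
  choose! N hN hlocal using fun x hx => hΩ.exists_nhds_setIntegral_fderiv (x₀ := x) hx
  obtain ⟨t, ψ, hψ, hsum⟩ := exists_contDiff_sum_eq_one hΩ.isCompact_closure hN
  have hbounded (i : t) : HasBoundedFDerivOn (fun x => ψ i x * V x) Ω :=
    (HasBoundedFDerivOn.of_contDiffOn hΩ.isOpen hΩ.isCompact_closure
      ((hψ i).2.1.of_le (by exact_mod_cast le_top)).contDiffOn).mul hV hΩ.isCompact_closure
  have hsupport (i : t) : HasCompactSupport (fun x => ψ i x * V x) := (hψ i).2.2.1.mul_right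
  have hfderiv : ∀ x ∈ Ω, fderiv ℝ V x a = ∑ i, fderiv ℝ (fun x => ψ i x * V x) x a := by
    intro x hx
    have hev : V =ᶠ[𝓝 x] fun z => ∑ i, ψ i z * V z := by
      filter_upwards [hΩ.isOpen.mem_nhds hx] with z hz
      rw [← Finset.sum_mul, hsum z (subset_closure hz), one_mul]
    rw [hev.fderiv_eq, fderiv_fun_sum fun i _ => (hbounded i).differentiableAt x hx, sum_apply]
  calc ∫ x in Ω, fderiv ℝ V x a
      = ∑ i, ∫ x in Ω, fderiv ℝ (fun x => ψ i x * V x) x a := by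
        rw [setIntegral_congr_fun hΩ.isOpen.measurableSet hfderiv, integral_finsetSum]
        exact fun i _ => (hbounded i).integrableOn_fderiv_apply hΩ.isOpen
          (measure_ne_top_of_subset inter_subset_left hΩ.isBounded.measure_lt_top.ne) a
    _ = ∑ i, ∫ x, ψ i x * V x * ⟪outwardNormal Ω x, a⟫ ∂surfaceMeasure Ω :=
        Finset.sum_congr rfl fun i _ => hlocal i (hψ i).1 _ (hbounded i) (hsupport i)
          ((tsupport_mul_subset_left).trans (hψ i).2.2.2) a
    _ = ∫ x, V x * ⟪outwardNormal Ω x, a⟫ ∂surfaceMeasure Ω := by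
        rw [← integral_finsetSum _ fun i _ => hΩ.integrable_mul_inner_outwardNormal
          ((hbounded i).continuousOn.mono frontier_subset_closure) a]
        refine integral_congr_ae ?_
        filter_upwards [ae_mem_frontier Ω] with x hx
        rw [← Finset.sum_mul, ← Finset.sum_mul, hsum x (frontier_subset_closure hx), one_mul]

end IsLipschitzDomain

end Domain

section Superposition

theorem aestronglyMeasurable_comp_prodMk_of_continuousOn {X Y Z : Type*} [TopologicalSpace X]
    [MeasurableSpace X] [BorelSpace X] [SecondCountableTopology X] [TopologicalSpace Y]
    [MeasurableSpace Y] [BorelSpace Y] [SecondCountableTopology Y]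
    [TopologicalSpace.PseudoMetrizableSpace Y] [TopologicalSpace Z]
    [TopologicalSpace.PseudoMetrizableSpace Z] [SecondCountableTopology Z] [MeasurableSpace Z]
    [BorelSpace Z] [Zero Z] {μ : Measure X} {T : Set X} (hT : MeasurableSet T) {q : X × Y → Z}
    (hq : ContinuousOn q (T ×ˢ univ)) {v : X → Y} (hv : AEStronglyMeasurable v (μ.restrict T)) :
    AEStronglyMeasurable (fun x => q (x, v x)) (μ.restrict T) := by
  classical
  have hpiecewise : Measurable ((T ×ˢ (univ : Set Y)).piecewise q fun _ => 0) :=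
    hq.measurable_piecewise continuousOn_const (hT.prod MeasurableSet.univ)
  have hcomp := hpiecewise.comp_aemeasurable (aemeasurable_id.prodMk hv.aemeasurable)
  refine (hcomp.congr ?_).aestronglyMeasurable
  filter_upwards [ae_restrict_mem hT] with x hx
  exact piecewise_eq_of_mem _ _ _ ⟨hx, mem_univ (v x)⟩

variable {X Y : Type*} [MeasurableSpace X] {μ : Measure X} [NormedAddCommGroup Y] {p C : ℝ}

theorem integrable_of_growth [IsFiniteMeasure μ] (hp : 0 < p) {f : X → ℝ}
    (hf : AEStronglyMeasurable f μ) {v : X → Y} (hv : MemLp v (ENNReal.ofReal p) μ)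
    (hfv : ∀ᵐ x ∂μ, |f x| ≤ C * (1 + ‖v x‖ ^ p)) : Integrable f μ := by
  have hvp := hv.integrable_norm_rpow (by simpa using hp) ENNReal.ofReal_ne_top
  rw [ENNReal.toReal_ofReal hp.le] at hvp
  exact (((integrable_const (1 : ℝ)).add hvp).const_mul C).mono' hf hfv

theorem integrable_comp_prodMk_of_growth [TopologicalSpace X] [BorelSpace X]
    [SecondCountableTopology X] [MeasurableSpace Y] [BorelSpace Y] [SecondCountableTopology Y]
    {T : Set X} [IsFiniteMeasure (μ.restrict T)] (hp : 0 < p) (hT : MeasurableSet T)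
    {q : X × Y → ℝ} (hq : ContinuousOn q (T ×ˢ univ))
    (hC : ∀ᵐ x ∂μ.restrict T, ∀ y, |q (x, y)| ≤ C * (1 + ‖y‖ ^ p)) {v : X → Y}
    (hv : MemLp v (ENNReal.ofReal p) (μ.restrict T)) :
    Integrable (fun x => q (x, v x)) (μ.restrict T) := by
  refine integrable_of_growth (C := C) hp (aestronglyMeasurable_comp_prodMk_of_continuousOn hT hq
    hv.aestronglyMeasurable) hv ?_
  filter_upwards [hC] with x hx using hx (v x)

theorem norm_rpow_le_two_rpow_mul (hp : 0 ≤ p) (v w : Y) :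
    ‖w‖ ^ p ≤ 2 ^ p * (‖v‖ ^ p + ‖w - v‖ ^ p) := by
  have hmax : ‖w‖ ≤ 2 * max ‖v‖ ‖w - v‖ := by
    have htriangle := norm_add_le v (w - v)
    rw [add_sub_cancel] at htriangle
    linarith [le_max_left ‖v‖ ‖w - v‖, le_max_right ‖v‖ ‖w - v‖]
  calc ‖w‖ ^ p ≤ (2 * max ‖v‖ ‖w - v‖) ^ p := Real.rpow_le_rpow (norm_nonneg _) hmax hp
    _ = 2 ^ p * max ‖v‖ ‖w - v‖ ^ p := Real.mul_rpow (by norm_num) (by positivity)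
    _ ≤ 2 ^ p * (‖v‖ ^ p + ‖w - v‖ ^ p) := by
      gcongr
      rcases max_choice ‖v‖ ‖w - v‖ with h | h <;> rw [h]
      · exact le_add_of_nonneg_right (by positivity)
      · exact le_add_of_nonneg_left (by positivity)

theorem enorm_sub_le_min_add (hp : 0 ≤ p) {r s : ℝ} {v w : Y}
    (hr : |r| ≤ C * (1 + ‖w‖ ^ p)) (hs : |s| ≤ C * (1 + ‖v‖ ^ p)) :
    ‖r - s‖ₑ ≤ min ‖r - s‖ₑ (ENNReal.ofReal (C * (2 + (2 ^ p + 1) * ‖v‖ ^ p))) +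
      ENNReal.ofReal (C * 2 ^ p) * ‖w - v‖ₑ ^ p := by
  have hC : 0 ≤ C := nonneg_of_mul_nonneg_left ((abs_nonneg s).trans hs) (by positivity)
  rcases le_total ‖r - s‖ₑ (ENNReal.ofReal (C * (2 + (2 ^ p + 1) * ‖v‖ ^ p))) with h | h
  · rw [min_eq_left h]
    exact le_self_add
  · rw [min_eq_right h, ← ofReal_norm (w - v), ENNReal.ofReal_rpow_of_nonneg (norm_nonneg _) hp,
      ← ENNReal.ofReal_mul (by positivity), ← ENNReal.ofReal_add (by positivity) (by positivity),
      ← ofReal_norm (r - s), Real.norm_eq_abs]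
    apply ENNReal.ofReal_le_ofReal
    linarith [mul_le_mul_of_nonneg_left (norm_rpow_le_two_rpow_mul hp v w) hC, abs_sub r s]

theorem tendsto_lintegral_min_enorm_sub {E : Type*} [NormedAddCommGroup E] {F : ℕ → X → E}
    {G : X → E} {A : X → ℝ≥0∞} (hF : ∀ k, AEStronglyMeasurable (F k) μ)
    (hG : AEStronglyMeasurable G μ) (hA : AEMeasurable A μ) (hAfin : ∫⁻ x, A x ∂μ ≠ ⊤)
    (hlim : ∀ᵐ x ∂μ, Tendsto (fun k => F k x) atTop (𝓝 (G x))) :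
    Tendsto (fun k => ∫⁻ x, min ‖F k x - G x‖ₑ (A x) ∂μ) atTop (𝓝 0) := by
  rw [← lintegral_zero (μ := μ)]
  refine tendsto_lintegral_of_dominated_convergence' A
    (fun k => ((hF k).sub hG).enorm.min hA) (fun k => ae_of_all _ fun x => min_le_right _ _)
    hAfin ?_
  filter_upwards [hlim] with x hx
  have hdiff := (tendsto_sub_nhds_zero_iff.2 hx).enorm
  rw [enorm_zero] at hdiff
  exact tendsto_of_tendsto_of_tendsto_of_le_of_le tendsto_const_nhds hdiff
    (fun _ => zero_le) (fun _ => min_le_left _ _)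

theorem tendsto_lintegral_enorm_rpow {f : ℕ → X → Y} (hp : 0 < p)
    (h : Tendsto (fun k => eLpNorm (f k) (ENNReal.ofReal p) μ) atTop (𝓝 0)) :
    Tendsto (fun k => ∫⁻ x, ‖f k x‖ₑ ^ p ∂μ) atTop (𝓝 0) := by
  have hpow := h.ennrpow_const p
  rw [ENNReal.zero_rpow_of_pos hp] at hpow
  refine hpow.congr fun k => ?_
  rw [eLpNorm_eq_eLpNorm' (by simpa using hp) ENNReal.ofReal_ne_top, ENNReal.toReal_ofReal hp.le,
    lintegral_rpow_enorm_eq_rpow_eLpNorm' hp]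

theorem tendsto_lintegral_enorm_sub_of_growth [IsFiniteMeasure μ] (hp : 0 < p) {q : X → Y → ℝ}
    (hq : ∀ᵐ x ∂μ, Continuous (q x)) (hC : ∀ᵐ x ∂μ, ∀ y, |q x y| ≤ C * (1 + ‖y‖ ^ p))
    {v : X → Y} (hv : MemLp v (ENNReal.ofReal p) μ) {w : ℕ → X → Y}
    (hqv : AEStronglyMeasurable (fun x => q x (v x)) μ)
    (hqw : ∀ k, AEStronglyMeasurable (fun x => q x (w k x)) μ)
    (hae : ∀ᵐ x ∂μ, Tendsto (fun k => w k x) atTop (𝓝 (v x)))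
    (hlim : Tendsto (fun k => eLpNorm (w k - v) (ENNReal.ofReal p) μ) atTop (𝓝 0)) :
    Tendsto (fun k => ∫⁻ x, ‖q x (w k x) - q x (v x)‖ₑ ∂μ) atTop (𝓝 0) := by
  have hvp := hv.integrable_norm_rpow (by simpa using hp) ENNReal.ofReal_ne_top
  rw [ENNReal.toReal_ofReal hp.le] at hvp
  set A : X → ℝ := fun x => C * (2 + (2 ^ p + 1) * ‖v x‖ ^ p)
  have hA : Integrable A μ := ((integrable_const (2 : ℝ)).add (hvp.const_mul _)).const_mul _
  have hmin : Tendsto (fun k => ∫⁻ x, min ‖q x (w k x) - q x (v x)‖ₑ (ENNReal.ofReal (A x)) ∂μ)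
      atTop (𝓝 0) := by
    refine tendsto_lintegral_min_enorm_sub hqw hqv hA.aemeasurable.ennreal_ofReal
      hA.lintegral_lt_top.ne ?_
    filter_upwards [hq, hae] with x hqx hwx using (hqx.tendsto _).comp hwx
  have hpow := ENNReal.Tendsto.const_mul (a := ENNReal.ofReal (C * 2 ^ p))
    (tendsto_lintegral_enorm_rpow hp hlim) (Or.inr ENNReal.ofReal_ne_top)
  have hsum := hmin.add hpow
  rw [mul_zero, add_zero] at hsum
  refine tendsto_of_tendsto_of_tendsto_of_le_of_le tendsto_const_nhds hsum
    (fun _ => zero_le) fun k => ?_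
  have hmin_meas :
      AEMeasurable (fun x => min ‖q x (w k x) - q x (v x)‖ₑ (ENNReal.ofReal (A x))) μ :=
    ((hqw k).sub hqv).enorm.min hA.aemeasurable.ennreal_ofReal
  rw [← lintegral_const_mul' _ _ ENNReal.ofReal_ne_top, ← lintegral_add_left' hmin_meas]
  refine lintegral_mono_ae ?_
  filter_upwards [hC] with x hx using enorm_sub_le_min_add hp.le (hx _) (hx _)

theorem tendsto_integral_of_growth [IsFiniteMeasure μ] (hp : 0 < p) {q : X → Y → ℝ}
    (hq : ∀ᵐ x ∂μ, Continuous (q x)) (hC : ∀ᵐ x ∂μ, ∀ y, |q x y| ≤ C * (1 + ‖y‖ ^ p))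
    {v : X → Y} (hv : MemLp v (ENNReal.ofReal p) μ) {w : ℕ → X → Y}
    (hw : ∀ k, AEStronglyMeasurable (w k) μ)
    (hqv : AEStronglyMeasurable (fun x => q x (v x)) μ)
    (hqw : ∀ k, AEStronglyMeasurable (fun x => q x (w k x)) μ)
    (hlim : Tendsto (fun k => eLpNorm (w k - v) (ENNReal.ofReal p) μ) atTop (𝓝 0)) :
    Tendsto (fun k => ∫ x, q x (w k x) ∂μ) atTop (𝓝 (∫ x, q x (v x) ∂μ)) := by
  refine tendsto_of_subseq_tendsto fun ns hns => ?_
  have hlim_ns := hlim.comp hns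
  obtain ⟨ms, hms, hae⟩ := (tendstoInMeasure_of_tendsto_eLpNorm (by simpa using hp)
    (fun k => hw (ns k)) hv.aestronglyMeasurable hlim_ns).exists_seq_tendsto_ae
  have hlim_ms := hlim_ns.comp hms.tendsto_atTop
  refine ⟨ms, tendsto_integral_of_L1 _ hqv ?_ (tendsto_lintegral_enorm_sub_of_growth hp hq hC hv
    hqv (fun k => hqw _) hae hlim_ms)⟩
  filter_upwards [hlim_ms.eventually (gt_mem_nhds one_pos)] with k hk
  have hsub : MemLp (w (ns (ms k)) - v) (ENNReal.ofReal p) μ :=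
    ⟨(hw _).sub hv.aestronglyMeasurable, hk.trans ENNReal.one_lt_top⟩
  have hmemLp := hsub.add hv
  rw [sub_add_cancel] at hmemLp
  refine integrable_of_growth (C := C) hp (hqw _) hmemLp ?_
  filter_upwards [hC] with x hx using hx _

theorem tendsto_eLpNorm_prodMk_sub {Z : Type*} [NormedAddCommGroup Z] {r : ℝ≥0∞} (hr : 1 ≤ r)
    {v : X → Y} {v' : X → Z} {w : ℕ → X → Y} {w' : ℕ → X → Z} (hv : AEStronglyMeasurable v μ)
    (hv' : AEStronglyMeasurable v' μ) (hw : ∀ k, AEStronglyMeasurable (w k) μ)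
    (hw' : ∀ k, AEStronglyMeasurable (w' k) μ)
    (h : Tendsto (fun k => eLpNorm (fun x => w k x - v x) r μ) atTop (𝓝 0))
    (h' : Tendsto (fun k => eLpNorm (fun x => w' k x - v' x) r μ) atTop (𝓝 0)) :
    Tendsto (fun k => eLpNorm ((fun x => (w k x, w' k x)) - fun x => (v x, v' x)) r μ)
      atTop (𝓝 0) := by
  have hsum := h.add h'
  rw [add_zero] at hsum
  refine tendsto_of_tendsto_of_tendsto_of_le_of_le tendsto_const_nhds hsum
    (fun _ => zero_le) fun k => ?_
  calc eLpNorm ((fun x => (w k x, w' k x)) - fun x => (v x, v' x)) r μ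
      ≤ eLpNorm ((fun x => ‖w k x - v x‖) + fun x => ‖w' k x - v' x‖) r μ :=
        eLpNorm_mono_real fun x => max_le_add_of_nonneg (norm_nonneg _) (norm_nonneg _)
    _ ≤ eLpNorm (fun x => ‖w k x - v x‖) r μ + eLpNorm (fun x => ‖w' k x - v' x‖) r μ :=
        eLpNorm_add_le ((hw k).sub hv).norm ((hw' k).sub hv').norm hr
    _ = eLpNorm (fun x => w k x - v x) r μ + eLpNorm (fun x => w' k x - v' x) r μ := by
        rw [eLpNorm_norm (fun x => w k x - v x), eLpNorm_norm (fun x => w' k x - v' x)]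

end Superposition

section Growth

variable {Y Z : Type*} [NormedAddCommGroup Y] [NormedAddCommGroup Z] {p C : ℝ}

theorem mul_one_add_rpow_sub_one_le (hp : 1 ≤ p) {t : ℝ} (ht : 0 ≤ t) :
    t * (1 + t ^ (p - 1)) ≤ 2 * (1 + t ^ p) := by
  rcases le_total t 1 with h | h
  · calc t * (1 + t ^ (p - 1)) ≤ 1 * (1 + 1) := by
          gcongr
          exact Real.rpow_le_one ht h (sub_nonneg.2 hp)
      _ ≤ 2 * (1 + t ^ p) := by linarith [Real.rpow_nonneg ht p]
  · rw [mul_add, mul_one, Real.rpow_sub_one (by positivity), mul_div_cancel₀ _ (by positivity)]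
    linarith [Real.self_le_rpow_of_one_le h hp]

theorem abs_le_two_mul_one_add_norm_prodMk_rpow (hp : 0 ≤ p) {r : ℝ} {y : Y} {z : Z}
    (h : |r| ≤ C * (1 + ‖y‖ ^ p + ‖z‖ ^ p)) : |r| ≤ 2 * C * (1 + ‖(y, z)‖ ^ p) := by
  have hC : 0 ≤ C := nonneg_of_mul_nonneg_left ((abs_nonneg r).trans h) (by positivity)
  have hy : ‖y‖ ^ p ≤ ‖(y, z)‖ ^ p := by gcongr; exact norm_fst_le (y, z)
  have hz : ‖z‖ ^ p ≤ ‖(y, z)‖ ^ p := by gcongr; exact norm_snd_le (y, z)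
  calc |r| ≤ C * (1 + ‖y‖ ^ p + ‖z‖ ^ p) := h
    _ ≤ C * (2 * (1 + ‖(y, z)‖ ^ p)) := by gcongr; linarith
    _ = 2 * C * (1 + ‖(y, z)‖ ^ p) := by ring

end Growth

theorem abs_matEntry_le {n m : ℕ} (z : Grad n m) (j : Fin m) (i : Fin n) :
    |matEntry z j i| ≤ ‖z‖ := by
  have hcolumn := z.le_opNorm (EuclideanSpace.single i 1)
  rw [PiLp.norm_single, norm_one, mul_one] at hcolumn
  exact (PiLp.norm_apply_le (z (EuclideanSpace.single i 1)) j).trans hcolumn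

theorem IsLipschitzDomain.isFiniteMeasure_restrict {n : ℕ} {Ω : Set (Euc n)}
    (hΩ : IsLipschitzDomain Ω) : IsFiniteMeasure (volume.restrict Ω) :=
  MeasureTheory.isFiniteMeasure_restrict.2 hΩ.isBounded.measure_lt_top.ne

theorem IsSobolev.memLp_prodMk {n m : ℕ} {Ω : Set (Euc n)} {p : ℝ} {u : Euc n → Euc m}
    {Du : Euc n → Grad n m} (hu : IsSobolev Ω p u Du) :
    MemLp (fun x => (u x, Du x)) (ENNReal.ofReal p) (volume.restrict Ω) :=
  MemLp.of_fst_snd ⟨hu.memLp, hu.memLp_grad⟩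

namespace VariationalProblem

variable {n m : ℕ} {P : VariationalProblem n m} {φ : Euc n × Euc m → Euc n}

theorem p_pos : 0 < P.p :=
  one_pos.trans P.one_lt_p

theorem cylinder_mem_nhds {x : Euc n} (hx : x ∈ P.Ω) (y : Euc m) :
    closure P.Ω ×ˢ (univ : Set (Euc m)) ∈ 𝓝 (x, y) :=
  prod_mem_nhds (mem_of_superset (P.lipschitz.isOpen.mem_nhds hx) subset_closure) univ_mem

theorem dφ_eq_fderiv {x : Euc n} (hx : x ∈ P.Ω) (y : Euc m) : P.dφ φ x y = fderiv ℝ φ (x, y) :=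
  fderivWithin_of_mem_nhds (cylinder_mem_nhds hx y)

theorem dφ_apply_prodMk (x : Euc n) (y : Euc m) (a : Euc n) (v : Euc m) :
    P.dφ φ x y (a, v) =
      P.dφ φ x y (a, 0) + ∑ j, v j • P.dφ φ x y (0, EuclideanSpace.single j 1) := by
  have hv : v = ∑ j, v j • EuclideanSpace.single j (1 : ℝ) := by
    simpa using ((EuclideanSpace.basisFun (Fin m) ℝ).sum_repr v).symm
  conv_lhs => rw [← add_zero a, ← zero_add v, ← Prod.mk_add_mk, map_add, hv]
  simp only [← ContinuousLinearMap.inr_apply (R := ℝ), map_sum, map_smul]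

theorem totalDiv_eq_sum_dφ (x : Euc n) (y : Euc m) (z : Grad n m) :
    P.totalDiv φ x y z =
      ∑ i, P.dφ φ x y (EuclideanSpace.single i 1, z (EuclideanSpace.single i 1)) i := by
  rw [totalDiv, ← Finset.sum_add_distrib]
  refine Finset.sum_congr rfl fun i _ => ?_
  rw [dφ_apply_prodMk]
  simp only [PiLp.add_apply, WithLp.ofLp_sum, Finset.sum_apply, PiLp.smul_apply, smul_eq_mul,
    partialX, partialY, matEntry, mul_comm]

namespace MemΦ

theorem contDiffOn_comp (hφ : P.MemΦ φ) {s : Euc n → Euc m} (hs : ContDiff ℝ 1 s) (i : Fin n) :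
    ContDiffOn ℝ 1 (fun x => φ (x, s x) i) (closure P.Ω) :=
  (EuclideanSpace.proj (𝕜 := ℝ) i).contDiff.comp_contDiffOn
    (hφ.contDiffOn.comp (contDiff_id.prodMk hs).contDiffOn fun x hx => ⟨hx, mem_univ (s x)⟩)

theorem hasFDerivAt (hφ : P.MemΦ φ) {x : Euc n} (hx : x ∈ P.Ω) (y : Euc m) :
    HasFDerivAt φ (P.dφ φ x y) (x, y) := by
  rw [dφ_eq_fderiv hx]
  exact ((hφ.contDiffOn.contDiffAt (cylinder_mem_nhds hx y)).differentiableAt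
    one_ne_zero).hasFDerivAt

theorem totalDiv_comp (hφ : P.MemΦ φ) {s : Euc n → Euc m} {x : Euc n} (hx : x ∈ P.Ω)
    (hs : DifferentiableAt ℝ s x) :
    P.totalDiv φ x (s x) (fderiv ℝ s x) =
      ∑ i, fderiv ℝ (fun x => φ (x, s x) i) x (EuclideanSpace.single i 1) := by
  have hcomp : HasFDerivAt (fun x => φ (x, s x))
      ((P.dφ φ x (s x)).comp ((ContinuousLinearMap.id ℝ (Euc n)).prod (fderiv ℝ s x))) x :=
    (hφ.hasFDerivAt hx (s x)).comp x ((hasFDerivAt_id x).prodMk hs.hasFDerivAt)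
  rw [totalDiv_eq_sum_dφ]
  refine Finset.sum_congr rfl fun i _ => ?_
  have hcoord := (EuclideanSpace.proj (𝕜 := ℝ) i).hasFDerivAt.comp x hcomp
  exact (congrArg (· (EuclideanSpace.single i 1)) hcoord.fderiv).symm

theorem integral_totalDiv_of_contDiff (hφ : P.MemΦ φ) {s : Euc n → Euc m} (hs : ContDiff ℝ 1 s) :
    ∫ x in P.Ω, P.totalDiv φ x (s x) (fderiv ℝ s x) =
      ∫ x, ⟪φ (x, s x), outwardNormal P.Ω x⟫ ∂surfaceMeasure P.Ω := by
  have hΩ := P.lipschitz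
  have hbounded (i : Fin n) : HasBoundedFDerivOn (fun x => φ (x, s x) i) P.Ω :=
    .of_contDiffOn hΩ.isOpen hΩ.isCompact_closure (hφ.contDiffOn_comp hs i)
  have hfin (i : Fin n) : volume (P.Ω ∩ tsupport fun x => φ (x, s x) i) ≠ ⊤ :=
    measure_ne_top_of_subset inter_subset_left hΩ.isBounded.measure_lt_top.ne
  calc ∫ x in P.Ω, P.totalDiv φ x (s x) (fderiv ℝ s x)
      = ∑ i, ∫ x in P.Ω,
          fderiv ℝ (fun x => φ (x, s x) i) x (EuclideanSpace.single i 1) := by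
        rw [setIntegral_congr_fun hΩ.isOpen.measurableSet fun x hx =>
          hφ.totalDiv_comp hx (hs.differentiable one_ne_zero x)]
        exact integral_finsetSum _ fun i _ =>
          (hbounded i).integrableOn_fderiv_apply hΩ.isOpen (hfin i) _
    _ = ∑ i, ∫ x, φ (x, s x) i * ⟪outwardNormal P.Ω x, EuclideanSpace.single i 1⟫
          ∂surfaceMeasure P.Ω :=
        Finset.sum_congr rfl fun i _ => hΩ.setIntegral_fderiv (hbounded i) _
    _ = ∫ x, ⟪φ (x, s x), outwardNormal P.Ω x⟫ ∂surfaceMeasure P.Ω := by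
        rw [← integral_finsetSum _ fun i _ => hΩ.integrable_mul_inner_outwardNormal
          ((hbounded i).continuousOn.mono frontier_subset_closure) _]
        simp [PiLp.inner_apply, mul_comm]

theorem continuousOn_totalDiv (hφ : P.MemΦ φ) :
    ContinuousOn (fun q : Euc n × Euc m × Grad n m => P.totalDiv φ q.1 q.2.1 q.2.2)
      (P.Ω ×ˢ univ) := by
  have hfderiv : ContinuousOn (fderiv ℝ φ) (P.Ω ×ˢ univ) :=
    (hφ.contDiffOn.mono (prod_mono subset_closure subset_rfl)).continuousOn_fderiv_of_isOpen
      (P.lipschitz.isOpen.prod isOpen_univ) le_rfl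
  have hdφ : ContinuousOn (fun q : Euc n × Euc m × Grad n m => P.dφ φ q.1 q.2.1)
      (P.Ω ×ˢ univ) :=
    (hfderiv.comp (f := fun q : Euc n × Euc m × Grad n m => (q.1, q.2.1)) (by fun_prop)
      fun q hq => ⟨hq.1, mem_univ _⟩).congr fun q hq => dφ_eq_fderiv hq.1 q.2.1
  simp only [totalDiv_eq_sum_dφ]
  exact continuousOn_finsetSum _ fun i _ =>
    (EuclideanSpace.proj (𝕜 := ℝ) i).continuous.comp_continuousOn
      (hdφ.clm_apply (Continuous.continuousOn (by fun_prop)))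

theorem abs_sum_partialX_le (hφ : P.MemΦ φ) : ∃ C : ℝ, ∀ x ∈ closure P.Ω, ∀ y : Euc m,
    |∑ i, P.partialX φ i i x y| ≤ C * (1 + ‖y‖ ^ P.p) := by
  obtain ⟨C, hC⟩ := hφ.growth_x
  refine ⟨C, fun x hx y => (Finset.abs_sum_le_sum_abs _ _).trans ?_⟩
  exact (le_add_of_nonneg_left (Finset.sum_nonneg fun _ _ => abs_nonneg _)).trans (hC x hx y)

theorem abs_sum_partialY_mul_matEntry_le (hφ : P.MemΦ φ) : ∃ C : ℝ, ∀ x ∈ closure P.Ω,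
    ∀ (y : Euc m) (z : Grad n m), |∑ i, ∑ j, P.partialY φ i j x y * matEntry z j i| ≤
      C * (1 + max ‖y‖ ‖z‖ ^ P.p) := by
  obtain ⟨C, hC⟩ := hφ.growth_y
  refine ⟨C * 2, fun x hx y z => ?_⟩
  have hC0 : 0 ≤ C := nonneg_of_mul_nonneg_left ((Finset.sum_nonneg fun i _ =>
    Finset.sum_nonneg fun j _ => abs_nonneg _).trans (hC x hx y)) (by positivity)
  set t := max ‖y‖ ‖z‖
  have ht : 0 ≤ t := le_max_of_le_left (norm_nonneg y)
  calc |∑ i, ∑ j, P.partialY φ i j x y * matEntry z j i|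
      ≤ ∑ i, ∑ j, |P.partialY φ i j x y| * t := by
        refine (Finset.abs_sum_le_sum_abs _ _).trans (Finset.sum_le_sum fun i _ =>
          (Finset.abs_sum_le_sum_abs _ _).trans (Finset.sum_le_sum fun j _ => ?_))
        rw [abs_mul]
        gcongr
        exact (abs_matEntry_le z j i).trans (le_max_right _ _)
    _ = (∑ i, ∑ j, |P.partialY φ i j x y|) * t := by simp only [Finset.sum_mul]
    _ ≤ C * (1 + ‖y‖ ^ (P.p - 1)) * t := by gcongr; exact hC x hx y
    _ ≤ C * (1 + t ^ (P.p - 1)) * t := by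
        have hp := sub_nonneg.2 P.one_lt_p.le
        gcongr
        exact le_max_left _ _
    _ = C * (t * (1 + t ^ (P.p - 1))) := by ring
    _ ≤ C * (2 * (1 + t ^ P.p)) :=
        mul_le_mul_of_nonneg_left (mul_one_add_rpow_sub_one_le P.one_lt_p.le ht) hC0
    _ = C * 2 * (1 + t ^ P.p) := by ring

theorem totalDiv_growth (hφ : P.MemΦ φ) : ∃ C : ℝ, ∀ x ∈ closure P.Ω,
    ∀ q : Euc m × Grad n m, |P.totalDiv φ x q.1 q.2| ≤ C * (1 + ‖q‖ ^ P.p) := by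
  obtain ⟨C₁, hC₁⟩ := hφ.abs_sum_partialX_le
  obtain ⟨C₂, hC₂⟩ := hφ.abs_sum_partialY_mul_matEntry_le
  refine ⟨C₁ + C₂, fun x hx q => ?_⟩
  have hC₁0 : 0 ≤ C₁ :=
    nonneg_of_mul_nonneg_left ((abs_nonneg _).trans (hC₁ x hx 0)) (by positivity)
  have hp := P.p_pos.le
  calc |P.totalDiv φ x q.1 q.2|
      ≤ C₁ * (1 + ‖q.1‖ ^ P.p) + C₂ * (1 + ‖q‖ ^ P.p) :=
        (abs_add_le _ _).trans (add_le_add (hC₁ x hx q.1) (hC₂ x hx q.1 q.2))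
    _ ≤ C₁ * (1 + ‖q‖ ^ P.p) + C₂ * (1 + ‖q‖ ^ P.p) := by gcongr; exact norm_fst_le q
    _ = (C₁ + C₂) * (1 + ‖q‖ ^ P.p) := by ring

theorem abs_inner_outwardNormal_le (hφ : P.MemΦ φ) : ∃ C : ℝ, ∀ x ∈ closure P.Ω, ∀ y : Euc m,
    |⟪φ (x, y), outwardNormal P.Ω x⟫| ≤ C * (1 + ‖y‖ ^ P.p) := by
  obtain ⟨C, hC⟩ := hφ.growth_x
  refine ⟨C, fun x hx y => ?_⟩
  have hsum : |⟪φ (x, y), outwardNormal P.Ω x⟫| ≤ ∑ i, |φ (x, y) i| := by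
    rw [PiLp.inner_apply]
    refine (Finset.abs_sum_le_sum_abs _ _).trans (Finset.sum_le_sum fun i _ => ?_)
    have hnormal : |outwardNormal P.Ω x i| ≤ 1 :=
      (PiLp.norm_apply_le (outwardNormal P.Ω x) i).trans norm_outwardNormal_le
    simp only [RCLike.inner_apply, conj_trivial, abs_mul]
    exact mul_le_of_le_one_left (abs_nonneg _) hnormal
  exact hsum.trans ((le_add_of_nonneg_right (Finset.sum_nonneg fun _ _ => abs_nonneg _)).trans
    (hC x hx y))

theorem aestronglyMeasurable_inner_outwardNormal (hφ : P.MemΦ φ) {v : Euc n → Euc m}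
    (hv : AEStronglyMeasurable v (surfaceMeasure P.Ω)) :
    AEStronglyMeasurable (fun x => ⟪φ (x, v x), outwardNormal P.Ω x⟫) (surfaceMeasure P.Ω) :=
  (aestronglyMeasurable_comp_prodMk_of_continuousOn isClosed_frontier.measurableSet
    (hφ.contDiffOn.continuousOn.mono (prod_mono frontier_subset_closure subset_rfl)) hv).inner
    P.lipschitz.aemeasurable_outwardNormal.aestronglyMeasurable

end MemΦ

variable {u w : Euc n → Euc m} {Du : Euc n → Grad n m}

theorem integrableOn_bulk {f : Euc n → Euc m → Grad n m → ℝ}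
    (hf : ContinuousOn (fun q : Euc n × Euc m × Grad n m => f q.1 q.2.1 q.2.2) (P.Ω ×ˢ univ))
    (hfC : ∃ C : ℝ, ∀ᵐ x ∂(volume.restrict P.Ω), ∀ y z,
      |f x y z| ≤ C * (1 + ‖y‖ ^ P.p + ‖z‖ ^ P.p)) (hu : IsSobolev P.Ω P.p u Du) :
    IntegrableOn (fun x => f x (u x) (Du x)) P.Ω := by
  have := P.lipschitz.isFiniteMeasure_restrict
  obtain ⟨C, hC⟩ := hfC
  refine integrable_comp_prodMk_of_growth (C := 2 * C) P.p_pos P.lipschitz.isOpen.measurableSet hf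
    ?_ hu.memLp_prodMk
  filter_upwards [hC] with x hx q
    using abs_le_two_mul_one_add_norm_prodMk_rpow P.p_pos.le (hx q.1 q.2)

theorem integrable_boundary {g : Euc n → Euc m → ℝ}
    (hg : ContinuousOn (fun q : Euc n × Euc m => g q.1 q.2) (frontier P.Ω ×ˢ univ))
    (hgC : ∃ C : ℝ, ∀ᵐ x ∂(surfaceMeasure P.Ω), ∀ y, |g x y| ≤ C * (1 + ‖y‖ ^ P.p))
    (hw : MemLp w (ENNReal.ofReal P.p) (surfaceMeasure P.Ω)) :
    Integrable (fun x => g x (w x)) (surfaceMeasure P.Ω) := by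
  have : IsFiniteMeasure ((Measure.euclideanHausdorffMeasure (n - 1)).restrict (frontier P.Ω)) :=
    P.lipschitz.isFiniteMeasure_surfaceMeasure
  obtain ⟨C, hC⟩ := hgC
  exact integrable_comp_prodMk_of_growth P.p_pos isClosed_frontier.measurableSet hg hC hw

namespace MemΦ

theorem integrableOn_totalDiv (hφ : P.MemΦ φ) (hu : IsSobolev P.Ω P.p u Du) :
    IntegrableOn (fun x => P.totalDiv φ x (u x) (Du x)) P.Ω := by
  have := P.lipschitz.isFiniteMeasure_restrict
  have hΩ := P.lipschitz.isOpen.measurableSet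
  obtain ⟨C, hC⟩ := hφ.totalDiv_growth
  refine integrable_comp_prodMk_of_growth (C := C) (v := fun x => (u x, Du x)) P.p_pos hΩ
    hφ.continuousOn_totalDiv ?_ hu.memLp_prodMk
  filter_upwards [ae_restrict_mem hΩ] with x hx using hC x (subset_closure hx)

theorem integrable_inner_outwardNormal (hφ : P.MemΦ φ)
    (hw : MemLp w (ENNReal.ofReal P.p) (surfaceMeasure P.Ω)) :
    Integrable (fun x => ⟪φ (x, w x), outwardNormal P.Ω x⟫) (surfaceMeasure P.Ω) := by
  have := P.lipschitz.isFiniteMeasure_surfaceMeasure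
  obtain ⟨C, hC⟩ := hφ.abs_inner_outwardNormal_le
  refine integrable_of_growth (C := C) P.p_pos
    (hφ.aestronglyMeasurable_inner_outwardNormal hw.aestronglyMeasurable) hw ?_
  filter_upwards [ae_mem_frontier P.Ω] with x hx using hC x (frontier_subset_closure hx) (w x)

theorem tendsto_setIntegral_totalDiv (hφ : P.MemΦ φ) (hu : IsSobolev P.Ω P.p u Du)
    {s : ℕ → Euc n → Euc m} (hs : ∀ k, ContDiff ℝ 1 (s k))
    (hsu : Tendsto (fun k => eLpNorm (fun x => s k x - u x) (ENNReal.ofReal P.p)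
      (volume.restrict P.Ω)) atTop (𝓝 0))
    (hsDu : Tendsto (fun k => eLpNorm (fun x => fderiv ℝ (s k) x - Du x) (ENNReal.ofReal P.p)
      (volume.restrict P.Ω)) atTop (𝓝 0)) :
    Tendsto (fun k => ∫ x in P.Ω, P.totalDiv φ x (s k x) (fderiv ℝ (s k) x)) atTop
      (𝓝 (∫ x in P.Ω, P.totalDiv φ x (u x) (Du x))) := by
  have := P.lipschitz.isFiniteMeasure_restrict
  have hΩ := P.lipschitz.isOpen.measurableSet
  have hscont (k : ℕ) : Continuous (s k) := (hs k).continuous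
  have hDscont (k : ℕ) : Continuous (fderiv ℝ (s k)) := (hs k).continuous_fderiv one_ne_zero
  have hpair (k : ℕ) : AEStronglyMeasurable (fun x => (s k x, fderiv ℝ (s k) x))
      (volume.restrict P.Ω) := ((hscont k).prodMk (hDscont k)).aestronglyMeasurable
  obtain ⟨C, hC⟩ := hφ.totalDiv_growth
  refine tendsto_integral_of_growth (q := fun x (q : Euc m × Grad n m) => P.totalDiv φ x q.1 q.2)
    (v := fun x => (u x, Du x)) (w := fun k x => (s k x, fderiv ℝ (s k) x)) (C := C) P.p_pos
    ?_ ?_ hu.memLp_prodMk hpair ?_ (fun k => ?_) ?_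
  · filter_upwards [ae_restrict_mem hΩ] with x hx
    exact hφ.continuousOn_totalDiv.comp_continuous
      (f := fun q : Euc m × Grad n m => (x, q)) (by fun_prop) fun q => ⟨hx, mem_univ _⟩
  · filter_upwards [ae_restrict_mem hΩ] with x hx using hC x (subset_closure hx)
  · exact (hφ.integrableOn_totalDiv hu).aestronglyMeasurable
  · exact aestronglyMeasurable_comp_prodMk_of_continuousOn
      (v := fun x => (s k x, fderiv ℝ (s k) x)) hΩ hφ.continuousOn_totalDiv (hpair k)
  · exact tendsto_eLpNorm_prodMk_sub (by simpa using P.one_lt_p.le) hu.memLp.aestronglyMeasurable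
      hu.memLp_grad.aestronglyMeasurable (fun k => (hscont k).aestronglyMeasurable)
      (fun k => (hDscont k).aestronglyMeasurable) hsu hsDu

theorem tendsto_integral_inner_outwardNormal (hφ : P.MemΦ φ)
    (hw : MemLp w (ENNReal.ofReal P.p) (surfaceMeasure P.Ω)) {s : ℕ → Euc n → Euc m}
    (hs : ∀ k, AEStronglyMeasurable (s k) (surfaceMeasure P.Ω))
    (hsw : Tendsto (fun k => eLpNorm (fun x => s k x - w x) (ENNReal.ofReal P.p)
      (surfaceMeasure P.Ω)) atTop (𝓝 0)) :
    Tendsto (fun k => ∫ x, ⟪φ (x, s k x), outwardNormal P.Ω x⟫ ∂surfaceMeasure P.Ω) atTop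
      (𝓝 (∫ x, ⟪φ (x, w x), outwardNormal P.Ω x⟫ ∂surfaceMeasure P.Ω)) := by
  have := P.lipschitz.isFiniteMeasure_surfaceMeasure
  obtain ⟨C, hC⟩ := hφ.abs_inner_outwardNormal_le
  refine tendsto_integral_of_growth (q := fun x y => ⟪φ (x, y), outwardNormal P.Ω x⟫) (C := C)
    P.p_pos ?_ ?_ hw hs (hφ.integrable_inner_outwardNormal hw).aestronglyMeasurable
    (fun k => hφ.aestronglyMeasurable_inner_outwardNormal (hs k)) hsw
  · filter_upwards [ae_mem_frontier P.Ω] with x hx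
    exact (hφ.contDiffOn.continuousOn.comp_continuous (f := fun y : Euc m => (x, y))
      (by fun_prop) fun y => ⟨frontier_subset_closure hx, mem_univ y⟩).inner continuous_const
  · filter_upwards [ae_mem_frontier P.Ω] with x hx using hC x (frontier_subset_closure hx)

theorem integral_totalDiv (hφ : P.MemΦ φ) (hu : IsSobolev P.Ω P.p u Du)
    (hw : IsTrace P.Ω P.p u Du w) :
    ∫ x in P.Ω, P.totalDiv φ x (u x) (Du x) =
      ∫ x, ⟪φ (x, w x), outwardNormal P.Ω x⟫ ∂surfaceMeasure P.Ω := by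
  obtain ⟨hwLp, s, hs, hsu, hsDu, hsw⟩ := hw
  have hs' (k : ℕ) : ContDiff ℝ 1 (s k) := (hs k).of_le (by exact_mod_cast le_top)
  have hbulk := hφ.tendsto_setIntegral_totalDiv hu hs' hsu hsDu
  have hboundary := hφ.tendsto_integral_inner_outwardNormal hwLp
    (fun k => (hs k).continuous.aestronglyMeasurable) hsw
  simp only [hφ.integral_totalDiv_of_contDiff (hs' _)] at hbulk
  exact tendsto_nhds_unique hbulk hboundary

end MemΦ

namespace MemB

variable {η : ℝ} {h l : Euc n → ℝ}

theorem integrableOn_h (hB : P.MemB φ η h l) : IntegrableOn h P.Ω :=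
  (hB.h_cont.integrableOn_compact P.lipschitz.isCompact_closure).mono_set subset_closure

theorem integrable_l (hB : P.MemB φ η h l) : Integrable l (surfaceMeasure P.Ω) := by
  have := P.lipschitz.isFiniteMeasure_surfaceMeasure
  have hl : IntegrableOn l (frontier P.Ω) (surfaceMeasure P.Ω) :=
    hB.l_cont.integrableOn_compact P.lipschitz.isCompact_frontier
  rwa [IntegrableOn, surfaceMeasure_restrict_frontier] at hl

theorem integrableOn_bigF (hB : P.MemB φ η h l) (hu : IsSobolev P.Ω P.p u Du) :
    IntegrableOn (fun x => P.bigF φ η h x (u x) (Du x)) P.Ω :=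
  (((integrableOn_bulk P.f_cont P.f_growth hu).add (hB.memΦ.integrableOn_totalDiv hu)).sub
    ((integrableOn_bulk P.a_cont P.a_growth hu).const_mul η)).sub hB.integrableOn_h

theorem integrable_bigG (hB : P.MemB φ η h l)
    (hw : MemLp w (ENNReal.ofReal P.p) (surfaceMeasure P.Ω)) :
    Integrable (fun x => P.bigG φ η l x (w x)) (surfaceMeasure P.Ω) :=
  (((integrable_boundary P.g_cont P.g_growth hw).sub
    (hB.memΦ.integrable_inner_outwardNormal hw)).sub
      ((integrable_boundary P.b_cont P.b_growth hw).const_mul η)).sub hB.integrable_l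

theorem setIntegral_bigF (hB : P.MemB φ η h l) (hu : IsSobolev P.Ω P.p u Du) :
    ∫ x in P.Ω, P.bigF φ η h x (u x) (Du x) =
      (∫ x in P.Ω, P.f x (u x) (Du x)) + (∫ x in P.Ω, P.totalDiv φ x (u x) (Du x)) -
        η * (∫ x in P.Ω, P.a x (u x) (Du x)) - ∫ x in P.Ω, h x := by
  have hf := integrableOn_bulk P.f_cont P.f_growth hu
  have ha := (integrableOn_bulk P.a_cont P.a_growth hu).const_mul η
  have hD := hB.memΦ.integrableOn_totalDiv hu
  refine (integral_sub ((hf.add hD).sub ha) hB.integrableOn_h).trans ?_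
  rw [integral_sub' (hf.add hD) ha, integral_add' hf hD, integral_const_mul]

theorem integral_bigG (hB : P.MemB φ η h l)
    (hw : MemLp w (ENNReal.ofReal P.p) (surfaceMeasure P.Ω)) :
    ∫ x, P.bigG φ η l x (w x) ∂surfaceMeasure P.Ω =
      (∫ x, P.g x (w x) ∂surfaceMeasure P.Ω) -
        (∫ x, ⟪φ (x, w x), outwardNormal P.Ω x⟫ ∂surfaceMeasure P.Ω) -
        η * (∫ x, P.b x (w x) ∂surfaceMeasure P.Ω) - ∫ x, l x ∂surfaceMeasure P.Ω := by
  have hg := integrable_boundary P.g_cont P.g_growth hw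
  have hb := (integrable_boundary P.b_cont P.b_growth hw).const_mul η
  have hN := hB.memΦ.integrable_inner_outwardNormal hw
  refine (integral_sub ((hg.sub hN).sub hb) hB.integrable_l).trans ?_
  rw [integral_sub' (hg.sub hN) hb, integral_sub' hg hN, integral_const_mul]

theorem integral_bigF_add_integral_bigG (hB : P.MemB φ η h l) (hu : P.Admissible u Du w) :
    (∫ x in P.Ω, P.bigF φ η h x (u x) (Du x)) +
      ∫ x, P.bigG φ η l x (w x) ∂surfaceMeasure P.Ω = P.Ψ u Du w - P.dualObjective h l := by
  rw [hB.setIntegral_bigF hu.isSobolev, hB.integral_bigG hu.isTrace.1,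
    hB.memΦ.integral_totalDiv hu.isSobolev hu.isTrace, Ψ, dualObjective]
  linear_combination (-η) * hu.integral_constraint

theorem ae_bigF_nonneg (hB : P.MemB φ η h l) (hu : P.Admissible u Du w) :
    ∀ᵐ x ∂volume.restrict P.Ω, 0 ≤ P.bigF φ η h x (u x) (Du x) := by
  filter_upwards [ae_restrict_mem P.lipschitz.isOpen.measurableSet, hu.bulk_constraint] with x hx hc
  exact hB.F_nonneg (x, u x, Du x) ⟨subset_closure hx, hc⟩

theorem ae_bigG_nonneg (hB : P.MemB φ η h l) (hu : P.Admissible u Du w) :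
    ∀ᵐ x ∂surfaceMeasure P.Ω, 0 ≤ P.bigG φ η l x (w x) := by
  filter_upwards [P.lipschitz.ae_mem_regularBoundary, hu.boundary_constraint] with x hx hd
  exact hB.G_nonneg (x, w x) ⟨hx.1, hd⟩ hx

end MemB

end VariationalProblem

theorem ereal_sub_le_two_mul {v : EReal} {a b ε : ℝ} (ha : (a : EReal) ≤ v + (ε : EReal))
    (hb : v - (ε : EReal) ≤ (b : EReal)) : a - b ≤ 2 * ε := by
  induction v with
  | bot => simp at ha
  | top => simp at hb
  | coe v =>
    have hav : a ≤ v + ε := by exact_mod_cast ha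
    have hvb : v - ε ≤ b := by exact_mod_cast hb
    linarith

theorem measure_ge_le_ofReal_integral_div {X : Type*} [MeasurableSpace X] {μ : Measure X}
    [IsFiniteMeasure μ] {f : X → ℝ} (hf : Integrable f μ) (hf0 : 0 ≤ᵐ[μ] f) {δ : ℝ}
    (hδ : 0 < δ) : μ {x | δ ≤ f x} ≤ ENNReal.ofReal ((∫ x, f x ∂μ) / δ) := by
  rw [← ofReal_measureReal]
  apply ENNReal.ofReal_le_ofReal
  rw [le_div_iff₀ hδ, mul_comm]
  exact mul_meas_ge_le_integral_of_nonneg hf0 hf δ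

theorem mainTheorem8_general {n m : ℕ} (P : VariationalProblem n m) {u w : Euc n → Euc m}
    {Du : Euc n → Grad n m} (hu : P.Admissible u Du w) {φ : Euc n × Euc m → Euc n} {η : ℝ}
    {h l : Euc n → ℝ} (hB : P.MemB φ η h l) {δ : ℝ} (hδ : 0 < δ) :
    volume {x | x ∈ P.Ω ∧ δ ≤ P.bigF φ η h x (u x) (Du x)} +
      surfaceMeasure P.Ω {x | x ∈ frontier P.Ω ∧ δ ≤ P.bigG φ η l x (w x)} ≤
        ENNReal.ofReal ((P.Ψ u Du w - P.dualObjective h l) / δ) := by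
  have := P.lipschitz.isFiniteMeasure_restrict
  have := P.lipschitz.isFiniteMeasure_surfaceMeasure
  have hF0 := hB.ae_bigF_nonneg hu
  have hG0 := hB.ae_bigG_nonneg hu
  have hF := measure_ge_le_ofReal_integral_div (hB.integrableOn_bigF hu.isSobolev) hF0 hδ
  have hG := measure_ge_le_ofReal_integral_div (hB.integrable_bigG hu.isTrace.1) hG0 hδ
  rw [Measure.restrict_apply' P.lipschitz.isOpen.measurableSet, inter_comm] at hF
  rw [← hB.integral_bigF_add_integral_bigG hu, add_div, ENNReal.ofReal_add
    (div_nonneg (integral_nonneg_of_ae hF0) hδ.le) (div_nonneg (integral_nonneg_of_ae hG0) hδ.le)]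
  exact add_le_add hF ((measure_mono fun x hx => hx.2).trans hG)

theorem mainTheorem8 {n m : ℕ} (P : VariationalProblem n m)
    (hsharp : P.optimalValue = P.dualValue)
    (ε : ℝ) (hε : 0 < ε)
    (u : Euc n → Euc m) (Du : Euc n → Grad n m) (w : Euc n → Euc m)
    (hu : P.Admissible u Du w)
    (hu_opt : ((P.Ψ u Du w : ℝ) : EReal) ≤ P.optimalValue + ((ε : ℝ) : EReal))
    (φ : Euc n × Euc m → Euc n) (η : ℝ) (h l : Euc n → ℝ)
    (hB : P.MemB φ η h l)
    (hB_opt : P.optimalValue - ((ε : ℝ) : EReal) ≤ ((P.dualObjective h l : ℝ) : EReal))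
    (δ : ℝ) (hδ : 0 < δ) :
    volume {x | x ∈ P.Ω ∧ δ ≤ P.bigF φ η h x (u x) (Du x)} +
      surfaceMeasure P.Ω {x | x ∈ frontier P.Ω ∧ δ ≤ P.bigG φ η l x (w x)} ≤
        ENNReal.ofReal (2 * ε / δ) :=
  (mainTheorem8_general P hu hB hδ).trans (ENNReal.ofReal_le_ofReal
    (div_le_div_of_nonneg_right (ereal_sub_le_two_mul hu_opt hB_opt) hδ.le))
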